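/- Consider finite nonempty graphs $\Gamma$ embedded in the plane (possibly disconnected, with loops, multiple edges, and circle components without vertices allowed), with two kinds of edges, standard and wide, such that every vertex is trivalent and is an end of exactly one wide edge, and every wide edge joins two distinct vertices; such $\Gamma$, up to planar isotopy, are called planar trivalent graph diagrams. In a rectangle, with products read as vertical stacking: on two parallel strands let $1$ be the two vertical strands, $t$ the turn-back (a maximum joining the two lower endpoints below a minimum joining the two upper endpoints), $c$ the vertical wide edge whose upper vertex carries the two upper strands and whose lower vertex carries the two lower strands, and $h$ the horizontal wide edge whose left vertex carries the two left strands and whose right vertex carries the two right strands; on three strands let $c_i,t_i$ ($i=1,2$) be $c,t$ placed on the strands $i,i+1$. Let $b$ be one strand running through a vertical wide edge whose two end vertices are joined, on one side, by a further standard edge that bounds a two-sided face with the wide edge. Put $$\alpha=\frac{a-a^{-1}}{A-B}+1,\quad \beta=\frac{Aa^{-1}-Ba}{A-B}-A-B,\quad \gamma=\frac{B^2a-A^2a^{-1}}{A-B}+AB,\quad \delta=\frac{B^3a-A^3a^{-1}}{A-B}.$$ Theorem. There is exactly one function $P$ from planar trivalent graph diagrams (up to planar isotopy) to $\mathbb Z[A^{\pm1},B^{\pm1},a^{\pm1},(A-B)^{\pm1}]$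 with $P(\bigcirc)=1$ for a single circle which satisfies the following relations, where in each relation the small diagrams shown stand for the whole diagrams obtained by placing them in the same rectangle of one and the same, arbitrary, larger diagram: 1. $P(\Gamma\cup\bigcirc)=\alpha\,P(\Gamma)$ for every $\Gamma$ (nonempty), where $\bigcirc$ is a circle bounding a disc disjoint from $\Gamma$; 2. $P(c)=P(h)$; 3. $P(b)=\beta\,P(|)$, where $|$ is a single strand; 4. $P(c\,c)=(1-AB)\,P(1)+\gamma\,P(t)-(A+B)\,P(c)$; 5. $P(c_2c_1c_2)-P(c_1c_2c_1)=AB\,[P(c_2)-P(c_1)+P(t_2c_1)-P(t_1c_2)+P(c_1t_2)-P(c_2t_1)]+\delta\,[P(t_1)-P(t_2)]$. -/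

import Mathlib

/-!
# Planar trivalent graph diagrams with wide edges

A plane diagram is drawn in general position with respect to the height function and is read from
bottom to top as a finite sequence of elementary slices. Diagrams are considered up to planar
isotopy. The coefficient ring is `ℤ[A^{±1}, B^{±1}, a^{±1}, (A - B)^{±1}]`.
-/

noncomputable section

namespace PlanarTrivalent

/-! ## The coefficient ring -/

/-- The multiplicative set generated by `A = X 0`, `B = X 1`, `a = X 2` and `A - B`
in `ℤ[A, B, a]`. -/
def denominators : Submonoid (MvPolynomial (Fin 3) ℤ) :=
  Submonoid.closure {MvPolynomial.X 0, MvPolynomial.X 1, MvPolynomial.X 2,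
    MvPolynomial.X 0 - MvPolynomial.X 1}

/-- The ring `ℤ[A^{±1}, B^{±1}, a^{±1}, (A - B)^{±1}]`. -/
abbrev Coeff : Type := Localization denominators

/-- The variable `A`. -/
def vA : Coeff := algebraMap (MvPolynomial (Fin 3) ℤ) Coeff (MvPolynomial.X 0)

/-- The variable `B`. -/
def vB : Coeff := algebraMap (MvPolynomial (Fin 3) ℤ) Coeff (MvPolynomial.X 1)

/-- The variable `a`. -/
def va : Coeff := algebraMap (MvPolynomial (Fin 3) ℤ) Coeff (MvPolynomial.X 2)

/-- The inverse `a⁻¹`. -/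
def vaInv : Coeff :=
  Localization.mk 1 ⟨MvPolynomial.X 2, Submonoid.subset_closure (by simp)⟩

/-- The inverse `(A - B)⁻¹`. -/
def vzInv : Coeff :=
  Localization.mk 1 ⟨MvPolynomial.X 0 - MvPolynomial.X 1, Submonoid.subset_closure (by simp)⟩

theorem va_mul_vaInv : va * vaInv = 1 := by
  rw [va, vaInv, ← Localization.mk_one_eq_algebraMap, Localization.mk_mul, one_mul, mul_one]
  exact Localization.mk_self
    (⟨MvPolynomial.X 2, Submonoid.subset_closure (by simp)⟩ : denominators)

theorem sub_mul_vzInv : (vA - vB) * vzInv = 1 := by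
  rw [vA, vB, vzInv, ← map_sub, ← Localization.mk_one_eq_algebraMap, Localization.mk_mul,
    one_mul, mul_one]
  exact Localization.mk_self
    (⟨MvPolynomial.X 0 - MvPolynomial.X 1, Submonoid.subset_closure (by simp)⟩ : denominators)

/-- `α = (a - a⁻¹) / (A - B) + 1`. -/
def cα : Coeff := (va - vaInv) * vzInv + 1

/-- `β = (A a⁻¹ - B a) / (A - B) - A - B`. -/
def cβ : Coeff := (vA * vaInv - vB * va) * vzInv - vA - vB

/-- `γ = (B² a - A² a⁻¹) / (A - B) + A B`. -/
def cγ : Coeff := (vB ^ 2 * va - vA ^ 2 * vaInv) * vzInv + vA * vB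

/-- `δ = (B³ a - A³ a⁻¹) / (A - B)`. -/
def cδ : Coeff := (vB ^ 3 * va - vA ^ 3 * vaInv) * vzInv

/-! ## Slices, words and tangles -/

/-- The elementary pieces of a diagram. Strands that cross a horizontal level are pieces of
standard edges.
* `cup`: a local minimum of a standard edge;
* `cap`: a local maximum of a standard edge;
* `vert`: a vertical wide edge with its two end vertices; the upper vertex carries the two strands
  that leave through the top, the lower one the two strands that enter from the bottom;
* `horiz`: a horizontal wide edge with its two end vertices; the left vertex carries the lower left
  and the upper left strand, the right vertex the lower right and the upper right strand. -/
inductive Piece : Type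
  | cup
  | cap
  | vert
  | horiz

/-- Number of strands entering a piece from below. -/
def Piece.ins : Piece → ℕ
  | .cup => 0
  | .cap => 2
  | .vert => 2
  | .horiz => 2

/-- Number of strands leaving a piece at the top. -/
def Piece.outs : Piece → ℕ
  | .cup => 2
  | .cap => 0
  | .vert => 2
  | .horiz => 2

/-- A horizontal slice of a diagram: one elementary piece with `left` vertical strands to its left
(and any number of vertical strands to its right). -/
structure Slice : Type where
  piece : Piece
  left : ℕ

/-- Move a slice to the right by `p` strands. -/
def Slice.shift (p : ℕ) (s : Slice) : Slice := ⟨s.piece, p + s.left⟩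

/-- `Fits n w m`: the slices of `w`, stacked from bottom to top, form a diagram in a rectangle with
`n` endpoints at the bottom and `m` endpoints at the top. -/
def Fits : ℕ → List Slice → ℕ → Prop
  | n, [], m => n = m
  | n, s :: w, m =>
      s.left + s.piece.ins ≤ n ∧ Fits (n - s.piece.ins + s.piece.outs) w m

theorem Fits.append {n m k : ℕ} {u v : List Slice} (hu : Fits n u m) (hv : Fits m v k) :
    Fits n (u ++ v) k := by
  induction u generalizing n with
  | nil => cases hu; exact hv
  | cons s u ih => exact ⟨hu.1, ih hu.2⟩

theorem Fits.shift {n m : ℕ} {w : List Slice} (p q : ℕ) (h : Fits n w m) :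
    Fits (p + n + q) (w.map (Slice.shift p)) (p + m + q) := by
  induction w generalizing n with
  | nil => cases h; rfl
  | cons s w ih =>
    obtain ⟨h₁, h₂⟩ := h
    refine ⟨?_, ?_⟩
    · simp only [Slice.shift]
      omega
    · have h₃ := ih h₂
      have e : p + (n - s.piece.ins + s.piece.outs) + q =
          p + n + q - s.piece.ins + s.piece.outs := by omega
      rw [e] at h₃
      exact h₃

/-- A planar trivalent graph diagram in a rectangle, with `n` endpoints of standard edges at the
bottom and `m` at the top. -/
structure Tangle (n m : ℕ) : Type where
  word : List Slice
  fits : Fits n word m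

/-- The large diagram outside a rectangle with `k` bottom and `l` top endpoints: a part below the
rectangle, a part above it, and `left`, respectively `right`, vertical strands passing beside it. -/
structure Context (k l : ℕ) : Type where
  below : List Slice
  above : List Slice
  left : ℕ
  right : ℕ
  fits_below : Fits 0 below (left + k + right)
  fits_above : Fits (left + l + right) above 0

/-- Put a small diagram into the large diagram. -/
def Context.fill {k l : ℕ} (C : Context k l) (T : Tangle k l) : Tangle 0 0 where
  word := C.below ++ (T.word.map (Slice.shift C.left) ++ C.above)
  fits := C.fits_below.append ((T.fits.shift C.left C.right).append C.fits_above)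

/-- Small diagrams that differ by an elementary planar isotopy. -/
inductive LocalIsotopy : {k l : ℕ} → Tangle k l → Tangle k l → Prop
  /-- Two pieces side by side, with `j` strands between them, exchange their heights. -/
  | exchange (x y : Piece) (j : ℕ)
      (h : Fits (x.ins + j + y.ins) [⟨x, 0⟩, ⟨y, x.outs + j⟩] (x.outs + j + y.outs))
      (h' : Fits (x.ins + j + y.ins) [⟨y, x.ins + j⟩, ⟨x, 0⟩] (x.outs + j + y.outs)) :
      LocalIsotopy ⟨_, h⟩ ⟨_, h'⟩
  /-- A minimum followed by a maximum on its right is straightened. -/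
  | zigzag_right (h : Fits 1 [⟨.cup, 0⟩, ⟨.cap, 1⟩] 1) (h' : Fits 1 [] 1) :
      LocalIsotopy ⟨_, h⟩ ⟨_, h'⟩
  /-- A minimum followed by a maximum on its left is straightened. -/
  | zigzag_left (h : Fits 1 [⟨.cup, 1⟩, ⟨.cap, 0⟩] 1) (h' : Fits 1 [] 1) :
      LocalIsotopy ⟨_, h⟩ ⟨_, h'⟩
  /-- A maximum slides past a wide edge, which makes a quarter turn. -/
  | cap_vert (h : Fits 3 [⟨.vert, 1⟩, ⟨.cap, 0⟩] 1) (h' : Fits 3 [⟨.horiz, 0⟩, ⟨.cap, 1⟩] 1) :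
      LocalIsotopy ⟨_, h⟩ ⟨_, h'⟩
  | cap_horiz (h : Fits 3 [⟨.horiz, 1⟩, ⟨.cap, 0⟩] 1) (h' : Fits 3 [⟨.vert, 0⟩, ⟨.cap, 1⟩] 1) :
      LocalIsotopy ⟨_, h⟩ ⟨_, h'⟩
  /-- A minimum slides past a wide edge, which makes a quarter turn. -/
  | cup_vert (h : Fits 1 [⟨.cup, 0⟩, ⟨.vert, 1⟩] 3) (h' : Fits 1 [⟨.cup, 1⟩, ⟨.horiz, 0⟩] 3) :
      LocalIsotopy ⟨_, h⟩ ⟨_, h'⟩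
  | cup_horiz (h : Fits 1 [⟨.cup, 0⟩, ⟨.horiz, 1⟩] 3) (h' : Fits 1 [⟨.cup, 1⟩, ⟨.vert, 0⟩] 3) :
      LocalIsotopy ⟨_, h⟩ ⟨_, h'⟩

/-! ## Planar trivalent graph diagrams -/

/-- A closed nonempty diagram in general position. -/
structure Drawing : Type where
  tangle : Tangle 0 0
  nonempty : tangle.word ≠ []

/-- Two drawings that differ by one elementary planar isotopy. -/
def Drawing.Step (D E : Drawing) : Prop :=
  ∃ (k l : ℕ) (C : Context k l) (S T : Tangle k l),
    LocalIsotopy S T ∧ D.tangle = C.fill S ∧ E.tangle = C.fill T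

/-- Nonempty planar trivalent graph diagrams up to planar isotopy: finite plane graphs, possibly
disconnected, possibly with loops, multiple edges and circle components without vertices, such that
every vertex is trivalent and is an end of exactly one wide edge. (`Quot` is the quotient by the
equivalence relation generated by `Drawing.Step`.) -/
def Diagram : Type := Quot Drawing.Step

/-- The isotopy class of a closed nonempty diagram. -/
def Diagram.mk (T : Tangle 0 0) (h : T.word ≠ []) : Diagram := Quot.mk _ ⟨T, h⟩

theorem Context.fill_ne_nil {k l : ℕ} (C : Context k l) (T : Tangle k l)
    (h : 0 < k ∨ T.word ≠ []) : (C.fill T).word ≠ [] := by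
  intro e
  simp only [Context.fill, List.append_eq_nil_iff, List.map_eq_nil_iff] at e
  rcases h with h | h
  · have hb := C.fits_below
    rw [e.1] at hb
    simp only [Fits] at hb
    omega
  · exact h e.2.1

/-- The diagram obtained by putting a small diagram that has endpoints into the large one. -/
def Context.diagram {k l : ℕ} (C : Context (k + 1) l) (T : Tangle (k + 1) l) : Diagram :=
  Diagram.mk (C.fill T) (C.fill_ne_nil T (Or.inl (Nat.succ_pos k)))

/-! ## The small diagrams in the skein relations -/

/-- `n` parallel vertical strands (the empty diagram for `n = 0`). -/
def strands (n : ℕ) : Tangle n n := ⟨[], rfl⟩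

/-- A circle bounding an empty disc. -/
def circle : Tangle 0 0 := ⟨[⟨.cup, 0⟩, ⟨.cap, 0⟩], by simp [Fits, Piece.ins, Piece.outs]⟩

/-- The vertical wide edge. -/
def vertical : Tangle 2 2 := ⟨[⟨.vert, 0⟩], by simp [Fits, Piece.ins, Piece.outs]⟩

/-- The horizontal wide edge. -/
def horizontal : Tangle 2 2 := ⟨[⟨.horiz, 0⟩], by simp [Fits, Piece.ins, Piece.outs]⟩

/-- The turn-back `≍`. -/
def turnback : Tangle 2 2 :=
  ⟨[⟨.cap, 0⟩, ⟨.cup, 0⟩], by simp [Fits, Piece.ins, Piece.outs]⟩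

/-- A strand passing through a vertical wide edge, whose two end vertices are joined by a further
standard edge bounding with the wide edge a face with two sides. -/
def bypass : Tangle 1 1 :=
  ⟨[⟨.cup, 1⟩, ⟨.vert, 0⟩, ⟨.cap, 1⟩], by simp [Fits, Piece.ins, Piece.outs]⟩

/-- Two vertical wide edges on top of each other, joined by two parallel standard edges. -/
def digon : Tangle 2 2 :=
  ⟨[⟨.vert, 0⟩, ⟨.vert, 0⟩], by simp [Fits, Piece.ins, Piece.outs]⟩

/-- On three strands, the piece `c₁`: a vertical wide edge on the first two strands. -/
def c₁ : List Slice := [⟨.vert, 0⟩]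

/-- On three strands, the piece `c₂`: a vertical wide edge on the last two strands. -/
def c₂ : List Slice := [⟨.vert, 1⟩]

/-- On three strands, the piece `t₁`: a turn-back on the first two strands. -/
def t₁ : List Slice := [⟨.cap, 0⟩, ⟨.cup, 0⟩]

/-- On three strands, the piece `t₂`: a turn-back on the last two strands. -/
def t₂ : List Slice := [⟨.cap, 1⟩, ⟨.cup, 1⟩]

theorem fits_c₁ : Fits 3 c₁ 3 := by simp [c₁, Fits, Piece.ins, Piece.outs]
theorem fits_c₂ : Fits 3 c₂ 3 := by simp [c₂, Fits, Piece.ins, Piece.outs]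
theorem fits_t₁ : Fits 3 t₁ 3 := by simp [t₁, Fits, Piece.ins, Piece.outs]
theorem fits_t₂ : Fits 3 t₂ 3 := by simp [t₂, Fits, Piece.ins, Piece.outs]

/-- The closed diagram consisting of one circle. -/
def unknot : Diagram := Diagram.mk circle (by simp [circle])

/-! ## The graph skein relations -/

/-- `P` takes the value `1` on the unknot and satisfies the graph skein relations. In each relation
the small diagrams are put into one and the same large diagram `C`, which is arbitrary. -/
structure IsGraphPolynomial (P : Diagram → Coeff) : Prop where
  unknot : P unknot = 1
  /-- Removal of a circle that bounds a disc disjoint from the rest of the (nonempty) diagram. -/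
  circle : ∀ (C : Context 0 0) (h : (C.fill (strands 0)).word ≠ []),
    P (Diagram.mk (C.fill circle) (C.fill_ne_nil circle (Or.inr (by simp [circle])))) =
      cα * P (Diagram.mk (C.fill (strands 0)) h)
  /-- A vertical wide edge may be replaced by a horizontal one. -/
  flip : ∀ C : Context 2 2, P (C.diagram vertical) = P (C.diagram horizontal)
  /-- Removal of a wide edge that is bypassed by a standard edge. -/
  bypass : ∀ C : Context 1 1, P (C.diagram bypass) = cβ * P (C.diagram (strands 1))
  /-- Removal of a face bounded by two standard edges between two wide edges. -/
  digon : ∀ C : Context 2 2,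
    P (C.diagram digon) =
      (1 - vA * vB) * P (C.diagram (strands 2)) + cγ * P (C.diagram turnback)
        - (vA + vB) * P (C.diagram vertical)
  /-- `c₂c₁c₂ - c₁c₂c₁ =
    AB (c₂ - c₁ + t₂c₁ - t₁c₂ + c₁t₂ - c₂t₁) + δ (t₁ - t₂)`. -/
  triple : ∀ C : Context 3 3,
    P (C.diagram ⟨c₂ ++ (c₁ ++ c₂), fits_c₂.append (fits_c₁.append fits_c₂)⟩)
      - P (C.diagram ⟨c₁ ++ (c₂ ++ c₁), fits_c₁.append (fits_c₂.append fits_c₁)⟩) =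
    vA * vB *
      (P (C.diagram ⟨c₂, fits_c₂⟩) - P (C.diagram ⟨c₁, fits_c₁⟩)
        + P (C.diagram ⟨t₂ ++ c₁, fits_t₂.append fits_c₁⟩)
        - P (C.diagram ⟨t₁ ++ c₂, fits_t₁.append fits_c₂⟩)
        + P (C.diagram ⟨c₁ ++ t₂, fits_c₁.append fits_t₂⟩)
        - P (C.diagram ⟨c₂ ++ t₁, fits_c₂.append fits_t₁⟩))
    + cδ * (P (C.diagram ⟨t₁, fits_t₁⟩) - P (C.diagram ⟨t₂, fits_t₂⟩))

end PlanarTrivalent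

end

/-!
Under the relations the combination `σ = A + B t + c` behaves like a crossing of the Kauffman
(Dubrovnik) polynomial: with `σ' = B + A t + c` the digon relation says `σ σ' = 1`, the circle
and bypass relations say that a curl can be removed at the cost of a factor `a` or `a⁻¹`, a quarter
turn exchanges `σ` and `σ'`, and the triple relation says that `σ` satisfies the braid relation
(`Params.braid_sub_braid`). Moreover `σ - σ' = (A - B) (1 - t)`.

*Values are determined.* Let `P` satisfy the relations with values in any ring `R` to which the
coefficients are mapped by `φ`. Diagrams with `m` upper endpoints, paired by `P` with all their
complements, span a module in which the relations hold locally (`GraphSkein.skeinModule`). Normal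
forms are built inductively: a minimum at the far left is put on top of a normal form, and its right
leg is led over some of the other strands. The span of the normal forms is closed under adding a
minimum, a maximum or a wide edge (`SkeinModule.cup_mem_S`, `SkeinModule.cap_mem_S`,
`SkeinModule.c_mem_S`), since everything slides under a strand that runs above everything. With two
endpoints the only normal form is an arc, so every value of `P` lies in the image of `φ`
(`GraphSkein.mem_range`). For `R` the product of two copies of the coefficient ring, with the diagonal
map `φ`, this is uniqueness.

*Existence.* The orthogonal `R`-matrices in even dimension are built by adding hyperbolic planes to
the zero space (`YangBaxter.step`). Evaluating the slices of a diagram as operators gives a solution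
of the relations with real values, for real `0 < B < A` and `a = s ^ (2 n + 1)`, where
`s - s⁻¹ = A - B` (`exists_graphSkein`). A coefficient that vanishes at all these points is zero, so
the coefficient ring embeds into the product of copies of `ℝ` indexed by them. By
`GraphSkein.mem_range` the combined solution takes its values in the coefficient ring.
-/

noncomputable section

namespace PlanarTrivalent

/-! ### Parameters and the braid relation -/

/-- Values of `A`, `B`, `a`, with inverses of `a` and of `A - B`, in a commutative ring. -/
structure Params (k : Type*) [CommRing k] where
  A : k
  B : k
  a : k
  aInv : k
  zInv : k
  a_mul_aInv : a * aInv = 1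
  sub_mul_zInv : (A - B) * zInv = 1

namespace Params

variable {k : Type*} [CommRing k] (q : Params k)

/-- The value of a circle. -/
def α : k := (q.a - q.aInv) * q.zInv + 1

/-- The value of a bypassed wide edge. -/
def β : k := (q.A * q.aInv - q.B * q.a) * q.zInv - q.A - q.B

/-- The coefficient of the turn-back in the digon relation. -/
def γ : k := (q.B ^ 2 * q.a - q.A ^ 2 * q.aInv) * q.zInv + q.A * q.B

/-- The coefficient of the turn-backs in the relation for three wide edges. -/
def δ : k := (q.B ^ 3 * q.a - q.A ^ 3 * q.aInv) * q.zInv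

theorem curl_eq : q.A + q.B * q.α + q.β = q.aInv := by
  simp only [α, β]
  linear_combination q.aInv * q.sub_mul_zInv

theorem curl_eq' : q.B + q.A * q.α + q.β = q.a := by
  simp only [α, β]
  linear_combination q.a * q.sub_mul_zInv

theorem turnback_eq :
    q.A ^ 2 + q.B ^ 2 + q.A * q.B * q.α + (q.A + q.B) * q.β + q.γ = 0 := by
  simp only [α, β, γ]
  ring

theorem delta_eq :
    q.A ^ 2 * q.B + q.A * (q.B ^ 2 * q.α + 2 * q.B * q.β + q.γ) + q.B ^ 3 + q.B ^ 2 * q.β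
      + 2 * q.B * q.γ = q.δ := by
  simp only [α, β, γ, δ]
  ring

section Ring

variable {S : Type*} [Ring S] [Algebra k S]

/-- The positive crossing `A + B t + c`. -/
def crossing (c t : S) : S := q.A • 1 + q.B • t + c

/-- The negative crossing `B + A t + c`. -/
def crossingInv (c t : S) : S := q.B • 1 + q.A • t + c

/-- The digon relation says that the two crossings are inverse to each other. -/
theorem crossing_mul_crossingInv {c t : S} (htt : t * t = q.α • t) (htc : t * c = q.β • t)
    (hct : c * t = q.β • t)
    (hcc : c * c = (1 - q.A * q.B) • 1 + q.γ • t - (q.A + q.B) • c) :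
    q.crossing c t * q.crossingInv c t = 1 := by
  simp only [crossing, crossingInv, add_mul, mul_add, smul_mul_assoc, mul_smul_comm, one_mul,
    mul_one, htt, htc, hct, hcc]
  have h : (q.A ^ 2 + q.B ^ 2 + q.A * q.B * q.α + (q.A + q.B) * q.β + q.γ) • t = 0 := by
    rw [q.turnback_eq, zero_smul]
  linear_combination (norm := module) h

theorem crossingInv_mul_crossing {c t : S} (htt : t * t = q.α • t) (htc : t * c = q.β • t)
    (hct : c * t = q.β • t)
    (hcc : c * c = (1 - q.A * q.B) • 1 + q.γ • t - (q.A + q.B) • c) :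
    q.crossingInv c t * q.crossing c t = 1 := by
  simp only [crossing, crossingInv, add_mul, mul_add, smul_mul_assoc, mul_smul_comm, one_mul,
    mul_one, htt, htc, hct, hcc]
  have h : (q.A ^ 2 + q.B ^ 2 + q.A * q.B * q.α + (q.A + q.B) * q.β + q.γ) • t = 0 := by
    rw [q.turnback_eq, zero_smul]
  linear_combination (norm := module) h

/-- Conversely, the digon relation follows if the two crossings are inverse to each other. -/
theorem digon_of_crossing {c t : S} (htt : t * t = q.α • t) (htc : t * c = q.β • t)
    (hct : c * t = q.β • t) (h : q.crossing c t * q.crossingInv c t = 1) :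
    c * c = (1 - q.A * q.B) • 1 + q.γ • t - (q.A + q.B) • c := by
  simp only [crossing, crossingInv, add_mul, mul_add, smul_mul_assoc, mul_smul_comm, one_mul,
    mul_one, htt, htc, hct] at h
  have h' : (q.A ^ 2 + q.B ^ 2 + q.A * q.B * q.α + (q.A + q.B) * q.β + q.γ) • t = 0 := by
    rw [q.turnback_eq, zero_smul]
  linear_combination (norm := module) h - h'

/-- The defect of the braid relation is the defect of the relation for three wide edges. -/
theorem braid_sub_braid {c₁ c₂ t₁ t₂ : S} (ht₁ : t₁ * t₁ = q.α • t₁) (ht₂ : t₂ * t₂ = q.α • t₂)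
    (h₁₂₁ : t₁ * t₂ * t₁ = t₁) (h₂₁₂ : t₂ * t₁ * t₂ = t₂)
    (htc₁ : t₁ * c₁ = q.β • t₁) (hct₁ : c₁ * t₁ = q.β • t₁)
    (htc₂ : t₂ * c₂ = q.β • t₂) (hct₂ : c₂ * t₂ = q.β • t₂)
    (hcc₁ : c₁ * c₁ = (1 - q.A * q.B) • 1 + q.γ • t₁ - (q.A + q.B) • c₁)
    (hcc₂ : c₂ * c₂ = (1 - q.A * q.B) • 1 + q.γ • t₂ - (q.A + q.B) • c₂)
    (r₁ : t₁ * c₂ = t₁ * t₂ * c₁) (r₂ : t₂ * c₁ = t₂ * t₁ * c₂)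
    (l₁ : c₂ * t₁ = c₁ * t₂ * t₁) (l₂ : c₁ * t₂ = c₂ * t₁ * t₂) :
    q.crossing c₁ t₁ * q.crossing c₂ t₂ * q.crossing c₁ t₁
      - q.crossing c₂ t₂ * q.crossing c₁ t₁ * q.crossing c₂ t₂ =
    c₁ * c₂ * c₁ - c₂ * c₁ * c₂
      - (q.A * q.B) • (c₁ - c₂ + (t₁ * c₂ - t₂ * c₁ + c₂ * t₁ - c₁ * t₂))
      + q.δ • (t₁ - t₂) := by
  have e₁ : t₁ * c₂ * t₁ = q.β • t₁ := by
    rw [r₁, mul_assoc, hct₁, mul_smul_comm, h₁₂₁]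
  have e₂ : t₂ * c₁ * t₂ = q.β • t₂ := by
    rw [r₂, mul_assoc, hct₂, mul_smul_comm, h₂₁₂]
  have e₃ : t₁ * c₂ * c₁ = (1 - q.A * q.B) • (t₁ * t₂) + q.γ • t₁ - (q.A + q.B) • (t₁ * c₂) := by
    rw [r₁, mul_assoc, hcc₁, mul_sub, mul_add, mul_smul_comm, mul_smul_comm, mul_smul_comm,
      mul_one, h₁₂₁]
  have e₄ : t₂ * c₁ * c₂ = (1 - q.A * q.B) • (t₂ * t₁) + q.γ • t₂ - (q.A + q.B) • (t₂ * c₁) := by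
    rw [r₂, mul_assoc, hcc₂, mul_sub, mul_add, mul_smul_comm, mul_smul_comm, mul_smul_comm,
      mul_one, h₂₁₂]
  have e₅ : c₁ * c₂ * t₁ = (1 - q.A * q.B) • (t₂ * t₁) + q.γ • t₁ - (q.A + q.B) • (c₂ * t₁) := by
    rw [mul_assoc, l₁, ← mul_assoc, ← mul_assoc, hcc₁, sub_mul, add_mul, smul_mul_assoc,
      smul_mul_assoc, smul_mul_assoc, one_mul, sub_mul, add_mul, smul_mul_assoc,
      smul_mul_assoc, smul_mul_assoc, h₁₂₁]
  have e₆ : c₂ * c₁ * t₂ = (1 - q.A * q.B) • (t₁ * t₂) + q.γ • t₂ - (q.A + q.B) • (c₁ * t₂) := by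
    rw [mul_assoc, l₂, ← mul_assoc, ← mul_assoc, hcc₂, sub_mul, add_mul, smul_mul_assoc,
      smul_mul_assoc, smul_mul_assoc, one_mul, sub_mul, add_mul, smul_mul_assoc,
      smul_mul_assoc, smul_mul_assoc, h₂₁₂]
  have e₇ : c₁ * t₂ * c₁ = c₂ * t₁ * c₂ := by
    rw [l₂, mul_assoc, r₂, ← mul_assoc, ← mul_assoc, mul_assoc c₂, mul_assoc c₂, h₁₂₁]
  simp only [crossing, add_mul, mul_add, smul_mul_assoc, mul_smul_comm, one_mul, mul_one,
    ht₁, ht₂, h₁₂₁, h₂₁₂, htc₁, hct₁, htc₂, hct₂, hcc₁, hcc₂, e₁, e₂, e₃, e₄, e₅, e₆, e₇,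
    ← r₁, ← r₂, ← l₁, ← l₂, ← q.delta_eq]
  module

end Ring

end Params

/-! ### Modules of diagrams with free upper endpoints -/

/-- Diagrams in a half plane modulo the graph skein relations, in abstract form. `U m` is the module
of diagrams with `m` upper endpoints; `cup i`, `cap i` and `c i` put a minimum, a maximum or a wide
edge on top, with `i` strands to the left. The relations are required on `U m` only when all
the strands that they involve are present. -/
structure SkeinModule {k : Type*} [CommRing k] (q : Params k) (M : Type*) [AddCommGroup M]
    [Module k M] where
  U : ℕ → Submodule k M
  empty : M
  cup : ℕ → M →ₗ[k] M
  cap : ℕ → M →ₗ[k] M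
  c : ℕ → M →ₗ[k] M
  empty_mem : empty ∈ U 0
  cup_mem : ∀ {m i F}, F ∈ U m → i ≤ m → cup i F ∈ U (m + 2)
  cap_mem : ∀ {m i F}, F ∈ U (m + 2) → i ≤ m → cap i F ∈ U m
  c_mem : ∀ {m i F}, F ∈ U m → i + 2 ≤ m → c i F ∈ U m
  cup_cup : ∀ {m i j F}, F ∈ U m → i ≤ j → j ≤ m → cup i (cup j F) = cup (j + 2) (cup i F)
  cap_cup : ∀ {m i j F}, F ∈ U m → i ≤ j → j + 2 ≤ m → cap (j + 2) (cup i F) = cup i (cap j F)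
  cap_cup' : ∀ {m i j F}, F ∈ U m → i ≤ j → j + 2 ≤ m → cap i (cup (j + 2) F) = cup j (cap i F)
  cap_cap : ∀ {m i j F}, F ∈ U m → i ≤ j → j + 4 ≤ m → cap i (cap (j + 2) F) = cap j (cap i F)
  c_cup : ∀ {m i j F}, F ∈ U m → i ≤ j → j + 2 ≤ m → c (j + 2) (cup i F) = cup i (c j F)
  c_cup' : ∀ {m i j F}, F ∈ U m → i + 2 ≤ j → j ≤ m → c i (cup j F) = cup j (c i F)
  c_cap : ∀ {m i j F}, F ∈ U m → i ≤ j → j + 4 ≤ m → cap i (c (j + 2) F) = c j (cap i F)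
  c_cap' : ∀ {m i j F}, F ∈ U m → i + 2 ≤ j → j + 2 ≤ m → cap j (c i F) = c i (cap j F)
  c_c : ∀ {m i j F}, F ∈ U m → i + 2 ≤ j → j + 2 ≤ m → c i (c j F) = c j (c i F)
  zigzag : ∀ {m i F}, F ∈ U m → i + 1 ≤ m → cap (i + 1) (cup i F) = F
  zigzag' : ∀ {m i F}, F ∈ U m → i + 1 ≤ m → cap i (cup (i + 1) F) = F
  cap_turn : ∀ {m i F}, F ∈ U m → i + 3 ≤ m → cap i (c (i + 1) F) = cap (i + 1) (c i F)
  cup_turn : ∀ {m i F}, F ∈ U m → i + 1 ≤ m → c (i + 1) (cup i F) = c i (cup (i + 1) F)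
  circle : ∀ {m i F}, F ∈ U m → i ≤ m → cap i (cup i F) = q.α • F
  bypass : ∀ {m i F}, F ∈ U m → i + 1 ≤ m → cap (i + 1) (c i (cup (i + 1) F)) = q.β • F
  digon : ∀ {m i F}, F ∈ U m → i + 2 ≤ m →
    c i (c i F) = (1 - q.A * q.B) • F + q.γ • cup i (cap i F) - (q.A + q.B) • c i F
  triple : ∀ {m i F}, F ∈ U m → i + 3 ≤ m →
    c (i + 1) (c i (c (i + 1) F)) - c i (c (i + 1) (c i F)) =
      (q.A * q.B) • (c (i + 1) F - c i F + c i (cup (i + 1) (cap (i + 1) F))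
        - c (i + 1) (cup i (cap i F)) + cup (i + 1) (cap (i + 1) (c i F))
        - cup i (cap i (c (i + 1) F)))
      + q.δ • (cup i (cap i F) - cup (i + 1) (cap (i + 1) F))

namespace SkeinModule

variable {k : Type*} [CommRing k] {q : Params k} {M : Type*} [AddCommGroup M] [Module k M]
  (T : SkeinModule q M) {m i j : ℕ} {F G X : M}

/-- The crossing of the strands `i` and `i + 1`. -/
def σ (i : ℕ) : M →ₗ[k] M := q.crossing (S := Module.End k M) (T.c i) (T.cup i ∘ₗ T.cap i)

/-- The inverse crossing of the strands `i` and `i + 1`. -/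
def σInv (i : ℕ) : M →ₗ[k] M :=
  q.crossingInv (S := Module.End k M) (T.c i) (T.cup i ∘ₗ T.cap i)

theorem σ_apply (i : ℕ) (F : M) :
    T.σ i F = q.A • F + q.B • T.cup i (T.cap i F) + T.c i F := rfl

theorem σInv_apply (i : ℕ) (F : M) :
    T.σInv i F = q.B • F + q.A • T.cup i (T.cap i F) + T.c i F := rfl

theorem σInv_eq (i : ℕ) (F : M) :
    T.σInv i F = T.σ i F - (q.A - q.B) • F + (q.A - q.B) • T.cup i (T.cap i F) := by
  rw [σ_apply, σInv_apply]
  module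

theorem turn_mem (hF : F ∈ T.U m) (h : i + 2 ≤ m) : T.cup i (T.cap i F) ∈ T.U m := by
  obtain ⟨n, rfl⟩ : ∃ n, m = n + 2 := ⟨m - 2, by omega⟩
  exact T.cup_mem (T.cap_mem hF (by omega)) (by omega)

theorem σ_mem (hF : F ∈ T.U m) (h : i + 2 ≤ m) : T.σ i F ∈ T.U m :=
  add_mem (add_mem (Submodule.smul_mem _ _ hF) (Submodule.smul_mem _ _ (T.turn_mem hF h)))
    (T.c_mem hF h)

theorem cap_mem' (hF : F ∈ T.U m) (h : i + 2 ≤ m) : T.cap i F ∈ T.U (m - 2) := by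
  obtain ⟨n, rfl⟩ : ∃ n, m = n + 2 := ⟨m - 2, by omega⟩
  exact T.cap_mem hF (by omega)

/-! #### Curls -/

theorem c_cup_self (hF : F ∈ T.U m) (h : i ≤ m) : T.c i (T.cup i F) = q.β • T.cup i F := by
  -- The left leg of the minimum is bypassed; the bypass slides down through the minimum.
  have h₁ := T.cup_mem hF h
  rw [← T.bypass h₁ (i := i + 1) (by omega), ← T.cup_cup hF le_rfl h, T.cup_turn h₁ (by omega),
    T.c_cap' (T.cup_mem h₁ (by omega)) (m := m + 4) (by omega) (by omega),
    T.zigzag h₁ (by omega)]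

theorem cap_c_self (hF : F ∈ T.U m) (h : i + 2 ≤ m) : T.cap i (T.c i F) = q.β • T.cap i F := by
  have h₁ : T.cup i F ∈ T.U (m + 2) := T.cup_mem hF (by omega)
  have h₂ : T.cup (i + 1) F ∈ T.U (m + 2) := T.cup_mem hF (by omega)
  calc T.cap i (T.c i F) = T.cap i (T.c i (T.cap (i + 2) (T.cup (i + 1) F))) := by
        rw [T.zigzag hF (by omega)]
    _ = T.cap i (T.cap (i + 2) (T.c i (T.cup (i + 1) F))) := by
        rw [T.c_cap' h₂ le_rfl (by omega)]
    _ = T.cap i (T.cap i (T.c (i + 1) (T.cup i F))) := by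
        rw [T.cap_cap (T.c_mem h₂ (by omega)) le_rfl (by omega), T.cup_turn hF (by omega)]
    _ = q.β • T.cap i F := by
        rw [T.cap_turn h₁ (by omega), T.c_cup_self hF (by omega), map_smul, map_smul,
          T.zigzag hF (by omega)]

theorem σ_cup_self (hF : F ∈ T.U m) (h : i ≤ m) : T.σ i (T.cup i F) = q.aInv • T.cup i F := by
  rw [σ_apply, T.circle hF h, T.c_cup_self hF h, map_smul, ← q.curl_eq]
  module

theorem σInv_cup_self (hF : F ∈ T.U m) (h : i ≤ m) :
    T.σInv i (T.cup i F) = q.a • T.cup i F := by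
  rw [σInv_apply, T.circle hF h, T.c_cup_self hF h, map_smul, ← q.curl_eq']
  module

theorem cap_σ_self (hF : F ∈ T.U m) (h : i + 2 ≤ m) :
    T.cap i (T.σ i F) = q.aInv • T.cap i F := by
  rw [σ_apply, map_add, map_add, T.cap_c_self hF h, map_smul, map_smul,
    T.circle (T.cap_mem' hF h) (by omega), ← q.curl_eq]
  module

/-! #### Turning crossings -/

theorem cap_σ_turn (hF : F ∈ T.U m) (h : i + 3 ≤ m) :
    T.cap i (T.σ (i + 1) F) = T.cap (i + 1) (T.σInv i F) := by
  rw [σ_apply, σInv_apply, map_add, map_add, map_add, map_add, map_smul, map_smul, map_smul,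
    map_smul, T.zigzag (T.cap_mem' hF (by omega)) (by omega),
    T.zigzag' (T.cap_mem' hF (by omega)) (by omega), T.cap_turn hF h]
  module

theorem cap_σInv_turn (hF : F ∈ T.U m) (h : i + 3 ≤ m) :
    T.cap (i + 1) (T.σ i F) = T.cap i (T.σInv (i + 1) F) := by
  rw [σ_apply, σInv_apply, map_add, map_add, map_add, map_add, map_smul, map_smul, map_smul,
    map_smul, T.zigzag (T.cap_mem' hF (by omega)) (by omega),
    T.zigzag' (T.cap_mem' hF (by omega)) (by omega), T.cap_turn hF h]
  module

theorem σ_cup_turn (hF : F ∈ T.U m) (h : i + 1 ≤ m) :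
    T.σ (i + 1) (T.cup i F) = T.σInv i (T.cup (i + 1) F) := by
  rw [σ_apply, σInv_apply, T.zigzag hF h, T.zigzag' hF h, T.cup_turn hF h]
  module

theorem σ_cup_turn' (hF : F ∈ T.U m) (h : i + 1 ≤ m) :
    T.σ i (T.cup (i + 1) F) = T.σInv (i + 1) (T.cup i F) := by
  rw [σ_apply, σInv_apply, T.zigzag hF h, T.zigzag' hF h, T.cup_turn hF h]
  module

/-! #### Crossings commute with distant pieces -/

theorem σ_cup (hF : F ∈ T.U m) (hij : i ≤ j) (h : j + 2 ≤ m) :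
    T.σ (j + 2) (T.cup i F) = T.cup i (T.σ j F) := by
  simp only [σ_apply, map_add, map_smul, T.c_cup hF hij h, T.cap_cup hF hij h]
  rw [T.cup_cup (T.cap_mem' hF h) hij (by omega)]

theorem σ_cup' (hF : F ∈ T.U m) (hij : i + 2 ≤ j) (h : j ≤ m) :
    T.σ i (T.cup j F) = T.cup j (T.σ i F) := by
  obtain ⟨l, rfl⟩ : ∃ l, j = l + 2 := ⟨j - 2, by omega⟩
  simp only [σ_apply, map_add, map_smul, T.c_cup' hF hij h,
    T.cap_cup' hF (show i ≤ l by omega) h]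
  rw [T.cup_cup (T.cap_mem' hF (by omega)) (show i ≤ l by omega) (by omega)]

theorem cap_σ (hF : F ∈ T.U m) (hij : i ≤ j) (h : j + 4 ≤ m) :
    T.cap i (T.σ (j + 2) F) = T.σ j (T.cap i F) := by
  simp only [σ_apply, map_add, map_smul, T.c_cap hF hij h]
  rw [T.cap_cup' (T.cap_mem' hF (by omega)) hij (by omega), T.cap_cap hF hij h]

theorem cap_σ' (hF : F ∈ T.U m) (hij : i + 2 ≤ j) (h : j + 2 ≤ m) :
    T.cap j (T.σ i F) = T.σ i (T.cap j F) := by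
  obtain ⟨l, rfl⟩ : ∃ l, j = l + 2 := ⟨j - 2, by omega⟩
  simp only [σ_apply, map_add, map_smul, T.c_cap' hF hij h]
  rw [T.cap_cup (T.cap_mem' hF (by omega)) (show i ≤ l by omega) (by omega),
    T.cap_cap hF (show i ≤ l by omega) (by omega)]

theorem σ_σ (hF : F ∈ T.U m) (hij : i + 2 ≤ j) (h : j + 2 ≤ m) :
    T.σ i (T.σ j F) = T.σ j (T.σ i F) := by
  have hc := T.cap_mem' hF h
  conv_lhs => rw [σ_apply T j]
  conv_rhs => rw [σ_apply T j]
  rw [map_add, map_add, map_smul, map_smul, T.σ_cup' hc hij (by omega), T.cap_σ' hF hij h]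
  congr 1
  obtain ⟨l, rfl⟩ : ∃ l, j = l + 2 := ⟨j - 2, by omega⟩
  rw [σ_apply, σ_apply, map_add, map_add, map_smul, map_smul, T.c_c hF hij h,
    T.c_cap hF (show i ≤ l by omega) (by omega),
    T.c_cup (T.cap_mem' hF (by omega)) (show i ≤ l by omega) (by omega)]

/-! #### Inverses and the braid relation -/

section Restrict

variable (hi : i + 2 ≤ m)

/-- The action of a wide edge on diagrams with `m` endpoints. -/
def cEnd : Module.End k (T.U m) := (T.c i).restrict fun _ hF => T.c_mem hF hi

/-- The action of a turn-back on diagrams with `m` endpoints. -/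
def tEnd : Module.End k (T.U m) := (T.cup i ∘ₗ T.cap i).restrict fun _ hF => T.turn_mem hF hi

theorem coe_cEnd (F : T.U m) : (T.cEnd hi F : M) = T.c i F := rfl

theorem coe_tEnd (F : T.U m) : (T.tEnd hi F : M) = T.cup i (T.cap i F) := rfl

theorem tEnd_mul_tEnd : T.tEnd hi * T.tEnd hi = q.α • T.tEnd hi := by
  ext F
  simp [coe_tEnd, T.circle (T.cap_mem' F.2 hi) (show i ≤ m - 2 by omega)]

theorem tEnd_mul_cEnd : T.tEnd hi * T.cEnd hi = q.β • T.tEnd hi := by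
  ext F
  simp [coe_tEnd, coe_cEnd, T.cap_c_self F.2 hi]

theorem cEnd_mul_tEnd : T.cEnd hi * T.tEnd hi = q.β • T.tEnd hi := by
  ext F
  simp [coe_tEnd, coe_cEnd, T.c_cup_self (T.cap_mem' F.2 hi) (show i ≤ m - 2 by omega)]

theorem cEnd_mul_cEnd : T.cEnd hi * T.cEnd hi =
    (1 - q.A * q.B) • 1 + q.γ • T.tEnd hi - (q.A + q.B) • T.cEnd hi := by
  ext F
  simp [coe_tEnd, coe_cEnd, T.digon F.2 hi]

theorem coe_crossing (F : T.U m) : (q.crossing (T.cEnd hi) (T.tEnd hi) F : M) = T.σ i F := rfl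

end Restrict

theorem σ_σInv (hF : F ∈ T.U m) (h : i + 2 ≤ m) : T.σ i (T.σInv i F) = F :=
  congrArg (fun f : Module.End k (T.U m) => (f ⟨F, hF⟩ : M))
    (q.crossing_mul_crossingInv (T.tEnd_mul_tEnd h) (T.tEnd_mul_cEnd h) (T.cEnd_mul_tEnd h)
      (T.cEnd_mul_cEnd h))

theorem σInv_σ (hF : F ∈ T.U m) (h : i + 2 ≤ m) : T.σInv i (T.σ i F) = F :=
  congrArg (fun f : Module.End k (T.U m) => (f ⟨F, hF⟩ : M))
    (q.crossingInv_mul_crossing (T.tEnd_mul_tEnd h) (T.tEnd_mul_cEnd h) (T.cEnd_mul_tEnd h)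
      (T.cEnd_mul_cEnd h))

theorem braid (hF : F ∈ T.U m) (h : i + 3 ≤ m) :
    T.σ i (T.σ (i + 1) (T.σ i F)) = T.σ (i + 1) (T.σ i (T.σ (i + 1) F)) := by
  have h₁ : i + 2 ≤ m := by omega
  have h₂ : i + 1 + 2 ≤ m := by omega
  have z₁ : ∀ {G}, G ∈ T.U (m - 2) → T.cap (i + 1) (T.cup i G) = G :=
    fun hG => T.zigzag hG (by omega)
  have z₂ : ∀ {G}, G ∈ T.U (m - 2) → T.cap i (T.cup (i + 1) G) = G :=
    fun hG => T.zigzag' hG (by omega)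
  have key := q.braid_sub_braid (T.tEnd_mul_tEnd h₁) (T.tEnd_mul_tEnd h₂)
    (by ext F; simp [coe_tEnd, z₁, z₂, T.cap_mem' F.2 h₁])
    (by ext F; simp [coe_tEnd, z₁, z₂, T.cap_mem' F.2 h₂])
    (T.tEnd_mul_cEnd h₁) (T.cEnd_mul_tEnd h₁) (T.tEnd_mul_cEnd h₂) (T.cEnd_mul_tEnd h₂)
    (T.cEnd_mul_cEnd h₁) (T.cEnd_mul_cEnd h₂)
    (by
      ext F
      simp [coe_tEnd, coe_cEnd, z₂, T.cap_mem' (T.c_mem F.2 h₁) h₂, T.cap_turn F.2 h])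
    (by
      ext F
      simp [coe_tEnd, coe_cEnd, z₁, T.cap_mem' (T.c_mem F.2 h₁) h₂, T.cap_turn F.2 h])
    (by
      ext F
      simp [coe_tEnd, coe_cEnd, z₁, T.cap_mem' F.2 h₁,
        T.cup_turn (T.cap_mem' F.2 h₁) (show i + 1 ≤ m - 2 by omega)])
    (by
      ext F
      simp [coe_tEnd, coe_cEnd, z₂, T.cap_mem' F.2 h₂,
        T.cup_turn (T.cap_mem' F.2 h₂) (show i + 1 ≤ m - 2 by omega)])
  have key' := congrArg (fun f : Module.End k (T.U m) => (f ⟨F, hF⟩ : M)) key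
  simp only [LinearMap.sub_apply, LinearMap.add_apply, LinearMap.smul_apply, Module.End.mul_apply,
    Submodule.coe_sub, Submodule.coe_add, Submodule.coe_smul, coe_crossing, coe_tEnd,
    coe_cEnd] at key'
  have ht := T.triple hF h
  rw [← sub_eq_zero, key']
  linear_combination (norm := module) -ht

/-! ### Normal forms -/

/-- The chain of crossings `σ_{i + j - 1} ⋯ σ_{i + 1} σ_i`, by which strand `i` passes over the `j`
strands to its right. -/
def run (i : ℕ) : ℕ → M →ₗ[k] M
  | 0 => LinearMap.id
  | j + 1 => T.σ (i + j) ∘ₗ run i j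

theorem run_zero (i : ℕ) (F : M) : T.run i 0 F = F := rfl

theorem run_succ (i j : ℕ) (F : M) : T.run i (j + 1) F = T.σ (i + j) (T.run i j F) := rfl

theorem run_mem (hF : F ∈ T.U m) (h : i + j + 1 ≤ m) : T.run i j F ∈ T.U m := by
  induction j with
  | zero => exact hF
  | succ j ih => exact T.σ_mem (ih (by omega)) (by omega)

/-- The span of the normal forms with `m` upper endpoints. In a normal form the first endpoint
belongs to a minimum on top of a normal form with `m - 2` endpoints, and the right leg of the
minimum passes over some of the other strands. -/
def S : ℕ → Submodule k M
  | 0 => Submodule.span k {T.empty}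
  | 1 => ⊥
  | m + 2 => Submodule.span k {F | ∃ j ≤ m, ∃ G ∈ S m, T.run 1 j (T.cup 0 G) = F}

theorem run_cup_mem_S (hG : G ∈ T.S m) (h : j ≤ m) : T.run 1 j (T.cup 0 G) ∈ T.S (m + 2) :=
  Submodule.subset_span ⟨j, h, G, hG, rfl⟩

/-- A linear map sends all normal forms into `N` if it does so for the generating ones. -/
theorem map_S_succ {N : Submodule k M} (f : M →ₗ[k] M)
    (h : ∀ j ≤ m, ∀ G ∈ T.S m, f (T.run 1 j (T.cup 0 G)) ∈ N) (hF : F ∈ T.S (m + 2)) :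
    f F ∈ N := by
  have : T.S (m + 2) ≤ N.comap f := by
    rw [S, Submodule.span_le]
    rintro _ ⟨j, hj, G, hG, rfl⟩
    exact h j hj G hG
  exact this hF

theorem S_le_U : ∀ m, T.S m ≤ T.U m
  | 0 => by simpa [S] using T.empty_mem
  | 1 => bot_le
  | m + 2 => fun _ hF => T.map_S_succ LinearMap.id
      (fun _ _ _ hG => T.run_mem (T.cup_mem (S_le_U m hG) (Nat.zero_le _)) (by omega)) hF

/-! #### Chains and distant pieces -/

theorem run_cup (hF : F ∈ T.U m) (hi : j + 2 ≤ i) (h : i ≤ m) :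
    T.run 1 j (T.cup i F) = T.cup i (T.run 1 j F) := by
  induction j with
  | zero => rfl
  | succ j ih =>
    rw [run_succ, run_succ, ih (by omega),
      T.σ_cup' (T.run_mem hF (by omega)) (by omega) h]

theorem run_cap (hF : F ∈ T.U m) (hi : j + 2 ≤ i) (h : i + 2 ≤ m) :
    T.cap i (T.run 1 j F) = T.run 1 j (T.cap i F) := by
  induction j with
  | zero => rfl
  | succ j ih =>
    rw [run_succ, run_succ, T.cap_σ' (T.run_mem hF (by omega)) (by omega) h, ih (by omega)]

theorem run_σ (hF : F ∈ T.U m) (hi : j + 2 ≤ i) (h : i + 2 ≤ m) :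
    T.σ i (T.run 1 j F) = T.run 1 j (T.σ i F) := by
  induction j with
  | zero => rfl
  | succ j ih =>
    rw [run_succ, run_succ, ← T.σ_σ (T.run_mem hF (by omega)) (by omega) h, ih (by omega)]

/-! #### Sliding pieces under a chain -/

theorem σ_σ_cup (hF : F ∈ T.U m) (h : i + 1 ≤ m) :
    T.σ (i + 1) (T.σ i (T.cup (i + 1) F)) = T.cup i F := by
  rw [T.σ_cup_turn' hF h, T.σ_σInv (T.cup_mem hF (by omega)) (by omega)]

theorem σ_σ_cup' (hF : F ∈ T.U m) (h : i + 1 ≤ m) :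
    T.σ i (T.σ (i + 1) (T.cup i F)) = T.cup (i + 1) F := by
  rw [T.σ_cup_turn hF h, T.σ_σInv (T.cup_mem hF (by omega)) (by omega)]

theorem cap_σ_σ (hF : F ∈ T.U m) (h : i + 3 ≤ m) :
    T.cap i (T.σ (i + 1) (T.σ i F)) = T.cap (i + 1) F := by
  rw [T.cap_σ_turn (T.σ_mem hF (by omega)) h, T.σInv_σ hF (by omega)]

theorem cup_run (hF : F ∈ T.U m) (hi : i ≤ j) (h : j + 2 ≤ m) :
    T.cup (i + 1) (T.run 1 j F) = T.run 1 (j + 2) (T.cup (i + 2) F) := by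
  induction j, hi using Nat.le_induction with
  | base =>
    have h₁ : T.run 1 i F ∈ T.U m := T.run_mem hF (by omega)
    rw [run_succ, run_succ, T.run_cup hF (by omega) (by omega), add_comm 1 (i + 1),
      add_comm 1 i, T.σ_σ_cup h₁ (by omega)]
  | succ j hj ih =>
    rw [run_succ, run_succ, ← ih (by omega), show 1 + (j + 2) = 1 + j + 2 by omega,
      T.σ_cup (T.run_mem hF (by omega)) (by omega) (by omega)]

theorem cap_run (hF : F ∈ T.U m) (hi : i ≤ j) (h : j + 4 ≤ m) :
    T.cap (i + 1) (T.run 1 (j + 2) F) = T.run 1 j (T.cap (i + 2) F) := by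
  induction j, hi using Nat.le_induction with
  | base =>
    rw [run_succ, run_succ, add_comm 1 (i + 1), add_comm 1 i,
      T.cap_σ_σ (T.run_mem hF (by omega)) (by omega), T.run_cap hF (by omega) (by omega)]
  | succ j hj ih =>
    rw [run_succ T 1 (j + 2), run_succ T 1 j, ← ih (by omega),
      show 1 + (j + 2) = 1 + j + 2 by omega,
      T.cap_σ (T.run_mem hF (by omega)) (by omega) (by omega)]

theorem σ_run (hF : F ∈ T.U m) (hi : i ≤ j) (h : j + 4 ≤ m) :
    T.σ (i + 1) (T.run 1 (j + 2) F) = T.run 1 (j + 2) (T.σ (i + 2) F) := by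
  induction j, hi using Nat.le_induction with
  | base =>
    rw [run_succ, run_succ, add_comm 1 (i + 1), add_comm 1 i,
      T.braid (T.run_mem hF (by omega)) (by omega), T.run_σ hF (by omega) (by omega),
      run_succ, run_succ, add_comm 1 (i + 1), add_comm 1 i]
  | succ j hj ih =>
    rw [run_succ T 1 (j + 2), T.σ_σ (T.run_mem hF (by omega)) (by omega) (by omega),
      ih (by omega), ← run_succ]

theorem cap_zero_run (hF : F ∈ T.U m) (h : j + 3 ≤ m) :
    T.cap 0 (T.run 1 (j + 1) F) = T.run 0 j (T.cap 0 (T.σ 1 F)) := by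
  induction j with
  | zero => rfl
  | succ j ih =>
    rw [run_succ, run_succ T 0, ← ih (by omega), show 1 + (j + 1) = j + 2 by omega,
      zero_add, T.cap_σ (T.run_mem hF (by omega)) (by omega) (by omega)]

/-! #### The normal forms are closed under adding pieces -/

theorem cup_mem_S (hF : F ∈ T.S m) (h : i ≤ m) : T.cup i F ∈ T.S (m + 2) := by
  rcases i with _ | i
  · exact T.run_cup_mem_S (j := 0) hF (Nat.zero_le _)
  induction m using Nat.twoStepInduction generalizing i F with
  | zero => omega
  | one =>
    rw [S, Submodule.mem_bot] at hF
    simp [hF]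
  | more m ih _ =>
    have ih' : ∀ {i G}, G ∈ T.S m → i ≤ m → T.cup i G ∈ T.S (m + 2) := by
      intro i G hG hi
      rcases i with _ | i
      · exact T.run_cup_mem_S (j := 0) hG (Nat.zero_le _)
      · exact ih hG i hi
    refine T.map_S_succ (T.cup (i + 1)) (fun j hj G hG => ?_) hF
    have hU := T.S_le_U m hG
    have hX := T.cup_mem hU (Nat.zero_le m)
    rcases le_or_gt i j with hij | hij
    · rw [T.cup_run hX hij (by omega), ← T.cup_cup hU (Nat.zero_le i) (by omega)]
      exact T.run_cup_mem_S (ih' hG (by omega)) (by omega)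
    · obtain ⟨l, rfl⟩ : ∃ l, i = l + 1 := ⟨i - 1, by omega⟩
      rw [← T.run_cup hX (by omega) (by omega), ← T.cup_cup hU (Nat.zero_le l) (by omega)]
      exact T.run_cup_mem_S (ih' hG (by omega)) (by omega)

theorem σInv_mem_S (hσ : ∀ {i F}, F ∈ T.S m → i + 2 ≤ m → T.σ i F ∈ T.S m)
    (hcap : ∀ {i F}, F ∈ T.S m → i + 2 ≤ m → T.cap i F ∈ T.S (m - 2))
    (hF : F ∈ T.S m) (h : i + 2 ≤ m) : T.σInv i F ∈ T.S m := by
  rw [σInv_eq]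
  have ht := T.cup_mem_S (i := i) (hcap hF h) (by omega)
  rw [Nat.sub_add_cancel (by omega)] at ht
  exact add_mem (sub_mem (hσ hF h) (Submodule.smul_mem _ _ hF)) (Submodule.smul_mem _ _ ht)

theorem cap_and_σ_mem_S (m : ℕ) :
    (∀ {i F}, F ∈ T.S m → i + 2 ≤ m → T.cap i F ∈ T.S (m - 2)) ∧
      ∀ {i F}, F ∈ T.S m → i + 2 ≤ m → T.σ i F ∈ T.S m := by
  induction m using Nat.twoStepInduction with
  | zero => exact ⟨fun _ h => by omega, fun _ h => by omega⟩
  | one => exact ⟨fun _ h => by omega, fun _ h => by omega⟩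
  | more m ih _ =>
    obtain ⟨ihcap, ihσ⟩ := ih
    -- The right leg of the minimum meets a maximum at its right.
    have hadj : ∀ j, j + 1 ≤ m → ∀ G ∈ T.S m, T.cap (j + 1) (T.run 1 j (T.cup 0 G)) ∈ T.S m := by
      intro j
      induction j with
      | zero =>
        intro hj G hG
        rw [run_zero, T.zigzag (T.S_le_U m hG) (by omega)]
        exact hG
      | succ j ihj =>
        intro hj G hG
        have hU := T.S_le_U m hG
        have hX := T.cup_mem hU (Nat.zero_le m)
        have h₁ : T.cap (j + 1 + 1) (T.run 1 (j + 1) (T.cup 0 G)) =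
            T.cap (j + 1) (T.run 1 j (T.cup 0 (T.σInv j G))) := by
          rw [run_succ, add_comm 1 j, T.cap_σInv_turn (T.run_mem hX (by omega)) (by omega),
            σInv_eq, σInv_eq, T.run_σ hX (by omega) (by omega), T.run_cap hX (by omega) (by omega),
            T.cap_cup hU (Nat.zero_le j) (by omega), T.σ_cup hU (Nat.zero_le j) (by omega),
            ← T.run_cup (T.cup_mem (T.cap_mem' hU (by omega)) (Nat.zero_le _)) (by omega)
              (by omega), ← T.cup_cup (T.cap_mem' hU (by omega)) (Nat.zero_le j) (by omega)]
          simp only [map_add, map_sub, map_smul]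
        rw [h₁]
        exact ihj (by omega) _ (T.σInv_mem_S ihσ ihcap hG (by omega))
    have hcap : ∀ {i F}, F ∈ T.S (m + 2) → i ≤ m → T.cap i F ∈ T.S m := by
      intro i F hF hi
      refine T.map_S_succ (T.cap i) (fun j hj G hG => ?_) hF
      have hU := T.S_le_U m hG
      have hX := T.cup_mem hU (Nat.zero_le m)
      rcases Nat.eq_zero_or_pos i with rfl | hi₀
      · rcases j with _ | j
        · rw [run_zero, T.circle hU (Nat.zero_le _)]
          exact Submodule.smul_mem _ _ hG
        · rw [T.cap_zero_run hX (by omega), T.cap_σ_turn hX (by omega),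
            T.σInv_cup_self hU (Nat.zero_le _), map_smul, T.zigzag hU (by omega)]
          have hrun : ∀ l ≤ j, T.run 0 l (q.a • G) ∈ T.S m := by
            intro l
            induction l with
            | zero => exact fun _ => Submodule.smul_mem _ _ hG
            | succ l ihl =>
              intro hl
              rw [run_succ]
              exact ihσ (ihl (by omega)) (by omega)
          exact hrun j le_rfl
      · obtain ⟨i, rfl⟩ : ∃ l, i = l + 1 := ⟨i - 1, by omega⟩
        rcases lt_trichotomy i j with hij | rfl | hij
        · rcases (show i + 1 = j ∨ i + 2 ≤ j by omega) with rfl | hij'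
          · rw [run_succ, add_comm 1 i, T.cap_σ_self (T.run_mem hX (by omega)) (by omega)]
            exact Submodule.smul_mem _ _ (hadj i hi G hG)
          · obtain ⟨j, rfl⟩ : ∃ l, j = l + 2 := ⟨j - 2, by omega⟩
            obtain ⟨m, rfl⟩ : ∃ l, m = l + 2 := ⟨m - 2, by omega⟩
            rw [T.cap_run hX (by omega) (by omega), T.cap_cup hU (Nat.zero_le i) (by omega)]
            exact T.run_cup_mem_S (ihcap hG (by omega)) (by omega)
        · exact hadj i hi G hG
        · obtain ⟨i, rfl⟩ : ∃ l, i = l + 1 := ⟨i - 1, by omega⟩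
          obtain ⟨m, rfl⟩ : ∃ l, m = l + 2 := ⟨m - 2, by omega⟩
          rw [T.run_cap hX (by omega) (by omega), T.cap_cup hU (Nat.zero_le i) (by omega)]
          exact T.run_cup_mem_S (ihcap hG (by omega)) (by omega)
    have hσ : ∀ {i F}, F ∈ T.S (m + 2) → i + 1 ≤ m → T.σ (i + 1) F ∈ T.S (m + 2) := by
      intro i F hF hi
      refine T.map_S_succ (T.σ (i + 1)) (fun j hj G hG => ?_) hF
      have hU := T.S_le_U m hG
      have hX := T.cup_mem hU (Nat.zero_le m)
      rcases lt_trichotomy i j with hij | rfl | hij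
      · rcases (show i + 1 = j ∨ i + 2 ≤ j by omega) with rfl | hij'
        · have hY := T.run_cup_mem_S (j := i) hG (by omega)
          have hUY := T.S_le_U _ hY
          have hsq : T.σ (i + 1) (T.σ (i + 1) (T.run 1 i (T.cup 0 G))) =
              T.run 1 i (T.cup 0 G) + (q.A - q.B) • T.run 1 (i + 1) (T.cup 0 G)
                - (q.A - q.B) • q.aInv • T.cup (i + 1) (T.cap (i + 1)
                  (T.run 1 i (T.cup 0 G))) := by
            have h₁ := T.σInv_σ hUY (i := i + 1) (by omega)
            rw [σInv_eq, T.cap_σ_self hUY (by omega), map_smul] at h₁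
            rw [run_succ, add_comm 1 i]
            linear_combination (norm := module) h₁
          rw [run_succ, add_comm 1 i, hsq]
          exact sub_mem (add_mem hY (Submodule.smul_mem _ _ (T.run_cup_mem_S hG hj)))
            (Submodule.smul_mem _ _ (Submodule.smul_mem _ _
              (T.cup_mem_S (hcap hY hi) (by omega))))
        · obtain ⟨j, rfl⟩ : ∃ l, j = l + 2 := ⟨j - 2, by omega⟩
          rw [T.σ_run hX (by omega) (by omega), T.σ_cup hU (Nat.zero_le i) (by omega)]
          exact T.run_cup_mem_S (ihσ hG (by omega)) hj
      · rw [add_comm i 1, ← run_succ]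
        exact T.run_cup_mem_S hG (by omega)
      · obtain ⟨i, rfl⟩ : ∃ l, i = l + 1 := ⟨i - 1, by omega⟩
        rw [T.run_σ hX (by omega) (by omega), T.σ_cup hU (Nat.zero_le i) (by omega)]
        exact T.run_cup_mem_S (ihσ hG (by omega)) hj
    refine ⟨fun hF hi => hcap hF (by omega), fun {i F} hF hi => ?_⟩
    rcases i with _ | i
    · refine T.map_S_succ (T.σ 0) (fun j hj G hG => ?_) hF
      have hU := T.S_le_U m hG
      have hX := T.cup_mem hU (Nat.zero_le m)
      rcases j with _ | j
      · rw [run_zero, T.σ_cup_self hU (Nat.zero_le _)]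
        exact Submodule.smul_mem _ _ (T.run_cup_mem_S (j := 0) hG (Nat.zero_le _))
      · -- After the first two crossings are undone, only crossings away from strand `0` remain.
        have hslide : ∀ l ≤ j, T.σ 0 (T.run 1 (l + 1) (T.cup 0 G)) ∈ T.S (m + 2) := by
          intro l
          induction l with
          | zero =>
            intro _
            rw [run_succ, run_zero, add_zero, T.σ_σ_cup' hU (i := 0) (by omega)]
            exact T.cup_mem_S hG (by omega)
          | succ l ihl =>
            intro hl
            rw [run_succ, T.σ_σ (T.run_mem hX (by omega)) (by omega) (by omega),
              show 1 + (l + 1) = l + 1 + 1 by omega]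
            exact hσ (ihl (by omega)) (by omega)
        exact hslide j le_rfl
    · exact hσ hF (by omega)

theorem cap_mem_S (hF : F ∈ T.S (m + 2)) (h : i ≤ m) : T.cap i F ∈ T.S m :=
  (T.cap_and_σ_mem_S (m + 2)).1 hF (by omega)

theorem c_mem_S (hF : F ∈ T.S m) (h : i + 2 ≤ m) : T.c i F ∈ T.S m := by
  have h₁ : T.c i F = T.σ i F - q.A • F - q.B • T.cup i (T.cap i F) := by
    rw [σ_apply]
    module
  obtain ⟨m, rfl⟩ : ∃ l, m = l + 2 := ⟨m - 2, by omega⟩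
  rw [h₁]
  exact sub_mem (sub_mem ((T.cap_and_σ_mem_S (m + 2)).2 hF h) (Submodule.smul_mem _ _ hF))
    (Submodule.smul_mem _ _ (T.cup_mem_S (T.cap_mem_S hF (by omega)) (by omega)))

/-- A combination of diagrams with two endpoints which is in normal form is a multiple of an
arc. -/
theorem exists_eq_smul_cup (hF : F ∈ T.S 2) : ∃ x : k, F = x • T.cup 0 T.empty := by
  have : F ∈ Submodule.span k {T.cup 0 T.empty} := by
    refine T.map_S_succ LinearMap.id (fun j hj G hG => ?_) hF
    obtain rfl : j = 0 := by omega
    obtain ⟨x, rfl⟩ := Submodule.mem_span_singleton.1 hG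
    rw [run_zero, LinearMap.id_apply, map_smul]
    exact Submodule.smul_mem _ _ (Submodule.mem_span_singleton_self _)
  obtain ⟨x, hx⟩ := Submodule.mem_span_singleton.1 this
  exact ⟨x, hx.symm⟩

end SkeinModule

/-! ### The skein module of a solution of the skein relations -/

/-- The parameters `A`, `B`, `a` of the generic coefficient ring. -/
def genericParams : Params Coeff := ⟨vA, vB, va, vaInv, vzInv, va_mul_vaInv, sub_mul_vzInv⟩

/-- The graph skein relations for a function with values in a ring `R`, to which the
coefficients are transported by `φ`. -/
structure GraphSkein {R : Type*} [CommRing R] (φ : Coeff →+* R) (P : Diagram → R) : Prop where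
  unknot : P unknot = 1
  circle : ∀ (C : Context 0 0) (h : (C.fill (strands 0)).word ≠ []),
    P (Diagram.mk (C.fill circle) (C.fill_ne_nil circle (Or.inr (by simp [circle])))) =
      φ cα * P (Diagram.mk (C.fill (strands 0)) h)
  flip : ∀ C : Context 2 2, P (C.diagram vertical) = P (C.diagram horizontal)
  bypass : ∀ C : Context 1 1, P (C.diagram bypass) = φ cβ * P (C.diagram (strands 1))
  digon : ∀ C : Context 2 2,
    P (C.diagram digon) =
      φ (1 - vA * vB) * P (C.diagram (strands 2)) + φ cγ * P (C.diagram turnback)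
        - φ (vA + vB) * P (C.diagram vertical)
  triple : ∀ C : Context 3 3,
    P (C.diagram ⟨c₂ ++ (c₁ ++ c₂), fits_c₂.append (fits_c₁.append fits_c₂)⟩)
      - P (C.diagram ⟨c₁ ++ (c₂ ++ c₁), fits_c₁.append (fits_c₂.append fits_c₁)⟩) =
    φ (vA * vB) *
      (P (C.diagram ⟨c₂, fits_c₂⟩) - P (C.diagram ⟨c₁, fits_c₁⟩)
        + P (C.diagram ⟨t₂ ++ c₁, fits_t₂.append fits_c₁⟩)
        - P (C.diagram ⟨t₁ ++ c₂, fits_t₁.append fits_c₂⟩)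
        + P (C.diagram ⟨c₁ ++ t₂, fits_c₁.append fits_t₂⟩)
        - P (C.diagram ⟨c₂ ++ t₁, fits_c₂.append fits_t₁⟩))
    + φ cδ * (P (C.diagram ⟨t₁, fits_t₁⟩) - P (C.diagram ⟨t₂, fits_t₂⟩))

theorem Fits.append_iff {n m k : ℕ} {u v : List Slice} (hu : Fits n u m) :
    Fits n (u ++ v) k ↔ Fits m v k := by
  induction u generalizing n with
  | nil => cases hu; rfl
  | cons s u ih => exact ⟨fun h => (ih hu.2).1 h.2, fun h => ⟨hu.1, (ih hu.2).2 h⟩⟩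

theorem fits_cap : Fits 2 [⟨.cap, 0⟩] 0 := by simp [Fits, Piece.ins, Piece.outs]

/-- The uppermost slice of a nonempty diagram without upper endpoints is a maximum. -/
theorem Fits.exists_cap {w : List Slice} {n : ℕ} (h : Fits n w 0) (hw : w ≠ []) :
    ∃ u, Fits n u 2 ∧ w = u ++ [⟨.cap, 0⟩] := by
  induction w generalizing n with
  | nil => exact absurd rfl hw
  | cons s w ih =>
    obtain ⟨hs, h⟩ := h
    rcases w with _ | ⟨t, w⟩
    · obtain ⟨x, i⟩ := s
      refine ⟨[], ?_⟩
      cases x <;> simp only [Fits, Piece.ins, Piece.outs] at hs h ⊢ <;> try omega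
      obtain rfl : i = 0 := by omega
      exact ⟨by omega, rfl⟩
    · obtain ⟨u, hu, h⟩ := ih h (by simp)
      exact ⟨s :: u, ⟨hs, hu⟩, by rw [h]; rfl⟩

theorem Diagram.mk_congr {S T : Tangle 0 0} {hS : S.word ≠ []} {hT : T.word ≠ []}
    (h : S.word = T.word) : Diagram.mk S hS = Diagram.mk T hT := by
  cases S
  cases T
  cases h
  rfl

section Vec

variable {R : Type*} [CommRing R] (P : Diagram → R)

open Classical in
/-- The value of `P` on the closure of a diagram with two upper endpoints by a maximum. Every
nonempty closed diagram is such a closure, and such closures are never empty. The value is `0` on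
lists of slices which are no diagrams of this kind. -/
def closeValue (w : List Slice) : R :=
  if h : Fits 0 w 2 then P (Diagram.mk ⟨w ++ [⟨.cap, 0⟩], h.append fits_cap⟩ (by simp)) else 0

/-- A diagram below a level, as a function of the part of the diagram above the level. -/
def vec (u : List Slice) : List Slice → R := fun v => closeValue P (u ++ v)

/-- The context that consists of `u`, `v` and a closing maximum. -/
def closeContext {u v : List Slice} {l r k k' : ℕ} (hu : Fits 0 u (l + k + r))
    (hv : Fits (l + k' + r) v 2) : Context k k' :=
  ⟨u, v ++ [⟨.cap, 0⟩], l, r, hu, hv.append fits_cap⟩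

variable {P} {u : List Slice} {l r k k' : ℕ}

theorem fits_fill (hu : Fits 0 u (l + k + r)) (T : Tangle k k') (v : List Slice) :
    Fits 0 (u ++ (T.word.map (Slice.shift l) ++ v)) 2 ↔ Fits (l + k' + r) v 2 := by
  rw [hu.append_iff, (T.fits.shift l r).append_iff]

theorem vec_of_fits {v : List Slice} (hu : Fits 0 u (l + k + r)) (T : Tangle k k')
    (hv : Fits (l + k' + r) v 2) (h : ((closeContext hu hv).fill T).word ≠ []) :
    vec P u (T.word.map (Slice.shift l) ++ v) =
      P (Diagram.mk ((closeContext hu hv).fill T) h) := by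
  rw [vec, closeValue, dif_pos ((fits_fill hu T v).2 hv)]
  congr 1
  exact Diagram.mk_congr (by simp [Context.fill, closeContext])

theorem vec_of_not_fits {v : List Slice} (hu : Fits 0 u (l + k + r)) (T : Tangle k k')
    (hv : ¬ Fits (l + k' + r) v 2) : vec P u (T.word.map (Slice.shift l) ++ v) = 0 := by
  rw [vec, closeValue, dif_neg (mt (fits_fill hu T v).1 hv)]

theorem closeContext_fill_ne_nil {v : List Slice} (hu : Fits 0 u (l + k + r)) (T : Tangle k k')
    (hv : Fits (l + k' + r) v 2) : ((closeContext hu hv).fill T).word ≠ [] := by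
  simp [Context.fill, closeContext]

theorem vec_isotopy {S T : Tangle k k'} (h : LocalIsotopy S T) (hu : Fits 0 u (l + k + r))
    (v : List Slice) :
    vec P u (S.word.map (Slice.shift l) ++ v) = vec P u (T.word.map (Slice.shift l) ++ v) := by
  by_cases hv : Fits (l + k' + r) v 2
  · rw [vec_of_fits hu S hv (closeContext_fill_ne_nil hu S hv),
      vec_of_fits hu T hv (closeContext_fill_ne_nil hu T hv)]
    congr 1
    exact Quot.sound ⟨k, k', closeContext hu hv, S, T, h, rfl, rfl⟩
  · rw [vec_of_not_fits hu S hv, vec_of_not_fits hu T hv]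

theorem vec_of_context {v : List Slice} (hu : Fits 0 u (l + (k + 1) + r))
    (hv : Fits (l + k' + r) v 2) (T : Tangle (k + 1) k') :
    vec P u (T.word.map (Slice.shift l) ++ v) = P ((closeContext hu hv).diagram T) :=
  vec_of_fits hu T hv _

end Vec

section Module

variable {R : Type*} [CommRing R] [Algebra Coeff R] (P : Diagram → R)

/-- Linear combinations of diagrams with `m` upper endpoints. -/
def vecSpan (m : ℕ) : Submodule Coeff (List Slice → R) :=
  Submodule.span Coeff {F | ∃ u, Fits 0 u m ∧ vec P u = F}

/-- Put a slice on top of a diagram. -/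
def put (R : Type*) [CommRing R] [Algebra Coeff R] (x : Piece) (i : ℕ) :
    (List Slice → R) →ₗ[Coeff] (List Slice → R) :=
  LinearMap.funLeft Coeff R (List.cons ⟨x, i⟩)

variable {P} {m i j : ℕ} {F : List Slice → R}

theorem vec_mem {u : List Slice} (hu : Fits 0 u m) : vec P u ∈ vecSpan P m :=
  Submodule.subset_span ⟨u, hu, rfl⟩

theorem put_vec (x : Piece) (i : ℕ) (u : List Slice) :
    put R x i (vec P u) = vec P (u ++ [⟨x, i⟩]) := by
  funext v
  simp [put, vec, LinearMap.funLeft_apply]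

theorem put_mem (x : Piece) {n : ℕ} (hF : F ∈ vecSpan P m) (h : i + x.ins ≤ m)
    (hn : m - x.ins + x.outs = n) : put R x i F ∈ vecSpan P n := by
  subst hn
  have : vecSpan P m ≤ (vecSpan P (m - x.ins + x.outs)).comap (put R x i) := by
    rw [vecSpan, Submodule.span_le]
    rintro _ ⟨u, hu, rfl⟩
    rw [SetLike.mem_coe, Submodule.mem_comap, put_vec]
    exact vec_mem (hu.append ⟨h, rfl⟩)
  exact this hF

theorem put_cup_mem (hF : F ∈ vecSpan P m) (h : i ≤ m) : put R .cup i F ∈ vecSpan P (m + 2) :=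
  put_mem .cup hF (by simpa [Piece.ins] using h) (by simp [Piece.ins, Piece.outs])

theorem put_cap_mem (hF : F ∈ vecSpan P (m + 2)) (h : i ≤ m) : put R .cap i F ∈ vecSpan P m :=
  put_mem .cap hF (by simpa [Piece.ins] using h) (by simp [Piece.ins, Piece.outs])

theorem put_vert_mem (hF : F ∈ vecSpan P m) (h : i + 2 ≤ m) : put R .vert i F ∈ vecSpan P m :=
  put_mem .vert hF (by simpa [Piece.ins] using h) (by simp only [Piece.ins, Piece.outs]; omega)

theorem eq_of_vec {f g : (List Slice → R) →ₗ[Coeff] (List Slice → R)}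
    (h : ∀ u v, Fits 0 u m → f (vec P u) v = g (vec P u) v) (hF : F ∈ vecSpan P m) :
    f F = g F := by
  refine LinearMap.eqOn_span (R := Coeff) ?_ hF
  rintro _ ⟨u, hu, rfl⟩
  exact funext fun v => h u v hu

theorem put_exchange (x y : Piece) (j : ℕ) (hF : F ∈ vecSpan P m)
    (h : i + x.ins + j + y.ins ≤ m) :
    put R y (i + x.outs + j) (put R x i F) = put R x i (put R y (i + x.ins + j) F) := by
  refine eq_of_vec (f := put R y (i + x.outs + j) ∘ₗ put R x i)
    (g := put R x i ∘ₗ put R y (i + x.ins + j)) (fun u v hu => ?_) hF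
  obtain ⟨r, rfl⟩ : ∃ r, m = i + (x.ins + j + y.ins) + r :=
    ⟨m - (i + (x.ins + j + y.ins)), by omega⟩
  have key := vec_isotopy (P := P) (LocalIsotopy.exchange x y j
    ⟨by simp only []; omega, by simp only []; omega, by simp only [Fits]; omega⟩
    ⟨by simp only []; omega, by simp only []; omega, by simp only [Fits]; omega⟩) hu v
  simpa [Slice.shift, put, LinearMap.funLeft_apply, add_assoc] using key

theorem put_zigzag_right (hF : F ∈ vecSpan P m) (h : i + 1 ≤ m) :
    put R .cap (i + 1) (put R .cup i F) = F := by
  refine eq_of_vec (f := put R .cap (i + 1) ∘ₗ put R .cup i) (g := LinearMap.id)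
    (fun u v hu => ?_) hF
  obtain ⟨r, rfl⟩ : ∃ r, m = i + 1 + r := ⟨m - (i + 1), by omega⟩
  exact vec_isotopy (LocalIsotopy.zigzag_right (by simp [Fits, Piece.ins, Piece.outs]) rfl) hu v

theorem put_zigzag_left (hF : F ∈ vecSpan P m) (h : i + 1 ≤ m) :
    put R .cap i (put R .cup (i + 1) F) = F := by
  refine eq_of_vec (f := put R .cap i ∘ₗ put R .cup (i + 1)) (g := LinearMap.id)
    (fun u v hu => ?_) hF
  obtain ⟨r, rfl⟩ : ∃ r, m = i + 1 + r := ⟨m - (i + 1), by omega⟩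
  exact vec_isotopy (LocalIsotopy.zigzag_left (by simp [Fits, Piece.ins, Piece.outs]) rfl) hu v

theorem put_cap_vert (hF : F ∈ vecSpan P m) (h : i + 3 ≤ m) :
    put R .cap i (put R .vert (i + 1) F) = put R .cap (i + 1) (put R .horiz i F) := by
  refine eq_of_vec (f := put R .cap i ∘ₗ put R .vert (i + 1))
    (g := put R .cap (i + 1) ∘ₗ put R .horiz i) (fun u v hu => ?_) hF
  obtain ⟨r, rfl⟩ : ∃ r, m = i + 3 + r := ⟨m - (i + 3), by omega⟩
  exact vec_isotopy (LocalIsotopy.cap_vert (by simp [Fits, Piece.ins, Piece.outs])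
    (by simp [Fits, Piece.ins, Piece.outs])) hu v

theorem put_cup_vert (hF : F ∈ vecSpan P m) (h : i + 1 ≤ m) :
    put R .vert (i + 1) (put R .cup i F) = put R .horiz i (put R .cup (i + 1) F) := by
  refine eq_of_vec (f := put R .vert (i + 1) ∘ₗ put R .cup i)
    (g := put R .horiz i ∘ₗ put R .cup (i + 1)) (fun u v hu => ?_) hF
  obtain ⟨r, rfl⟩ : ∃ r, m = i + 1 + r := ⟨m - (i + 1), by omega⟩
  exact vec_isotopy (LocalIsotopy.cup_vert (by simp [Fits, Piece.ins, Piece.outs])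
    (by simp [Fits, Piece.ins, Piece.outs])) hu v

end Module

namespace GraphSkein

variable {R : Type*} [CommRing R] [Algebra Coeff R] {P : Diagram → R} {m i : ℕ} {F : List Slice → R}

theorem put_flip (hP : GraphSkein (algebraMap Coeff R) P)
    (hF : F ∈ vecSpan P m) (h : i + 2 ≤ m) :
    put R .horiz i F = put R .vert i F := by
  refine eq_of_vec (fun u v hu => ?_) hF
  obtain ⟨r, rfl⟩ : ∃ r, m = i + 2 + r := ⟨m - (i + 2), by omega⟩
  change vec P u (horizontal.word.map (Slice.shift i) ++ v) =
    vec P u (vertical.word.map (Slice.shift i) ++ v)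
  by_cases hv : Fits (i + 2 + r) v 2
  · rw [vec_of_context hu hv, vec_of_context hu hv, hP.flip]
  · rw [vec_of_not_fits hu _ hv, vec_of_not_fits hu _ hv]

theorem put_circle (hP : GraphSkein (algebraMap Coeff R) P)
    (hF : F ∈ vecSpan P m) (h : i ≤ m) :
    put R .cap i (put R .cup i F) = genericParams.α • F := by
  refine eq_of_vec (f := put R .cap i ∘ₗ put R .cup i)
    (g := genericParams.α • LinearMap.id) (fun u v hu => ?_) hF
  obtain ⟨r, rfl⟩ : ∃ r, m = i + 0 + r := ⟨m - i, by omega⟩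
  change vec P u (PlanarTrivalent.circle.word.map (Slice.shift i) ++ v) =
    cα • vec P u ((strands 0).word.map (Slice.shift i) ++ v)
  by_cases hv : Fits (i + 0 + r) v 2
  · rw [vec_of_fits hu _ hv (closeContext_fill_ne_nil hu _ hv),
      vec_of_fits hu _ hv (closeContext_fill_ne_nil hu _ hv), Algebra.smul_def]
    exact hP.circle _ _
  · rw [vec_of_not_fits hu _ hv, vec_of_not_fits hu _ hv, Algebra.smul_def, mul_zero]

theorem put_bypass (hP : GraphSkein (algebraMap Coeff R) P)
    (hF : F ∈ vecSpan P m) (h : i + 1 ≤ m) :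
    put R .cap (i + 1) (put R .vert i (put R .cup (i + 1) F)) = genericParams.β • F := by
  refine eq_of_vec (f := put R .cap (i + 1) ∘ₗ put R .vert i ∘ₗ put R .cup (i + 1))
    (g := genericParams.β • LinearMap.id) (fun u v hu => ?_) hF
  obtain ⟨r, rfl⟩ : ∃ r, m = i + 1 + r := ⟨m - (i + 1), by omega⟩
  change vec P u (PlanarTrivalent.bypass.word.map (Slice.shift i) ++ v) =
    cβ • vec P u ((strands 1).word.map (Slice.shift i) ++ v)
  by_cases hv : Fits (i + 1 + r) v 2
  · rw [vec_of_context hu hv, vec_of_context hu hv, Algebra.smul_def, hP.bypass]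
  · rw [vec_of_not_fits hu _ hv, vec_of_not_fits hu _ hv, Algebra.smul_def, mul_zero]

theorem put_digon (hP : GraphSkein (algebraMap Coeff R) P)
    (hF : F ∈ vecSpan P m) (h : i + 2 ≤ m) :
    put R .vert i (put R .vert i F) = (1 - vA * vB) • F
      + genericParams.γ • put R .cup i (put R .cap i F) - (vA + vB) • put R .vert i F := by
  refine eq_of_vec (f := put R .vert i ∘ₗ put R .vert i)
    (g := (1 - vA * vB) • LinearMap.id + genericParams.γ • (put R .cup i ∘ₗ put R .cap i)
      - (vA + vB) • put R .vert i) (fun u v hu => ?_) hF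
  obtain ⟨r, rfl⟩ : ∃ r, m = i + 2 + r := ⟨m - (i + 2), by omega⟩
  change vec P u (PlanarTrivalent.digon.word.map (Slice.shift i) ++ v) =
    (1 - vA * vB) • vec P u ((strands 2).word.map (Slice.shift i) ++ v)
      + cγ • vec P u (turnback.word.map (Slice.shift i) ++ v)
      - (vA + vB) • vec P u (vertical.word.map (Slice.shift i) ++ v)
  by_cases hv : Fits (i + 2 + r) v 2
  · rw [vec_of_context hu hv, vec_of_context hu hv, vec_of_context hu hv, vec_of_context hu hv,
      Algebra.smul_def, Algebra.smul_def, Algebra.smul_def, hP.digon]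
  · rw [vec_of_not_fits hu _ hv, vec_of_not_fits hu _ hv, vec_of_not_fits hu _ hv,
      vec_of_not_fits hu _ hv, Algebra.smul_def, Algebra.smul_def, Algebra.smul_def, mul_zero,
      mul_zero, mul_zero, add_zero, sub_zero]

theorem put_triple (hP : GraphSkein (algebraMap Coeff R) P)
    (hF : F ∈ vecSpan P m) (h : i + 3 ≤ m) :
    put R .vert (i + 1) (put R .vert i (put R .vert (i + 1) F))
      - put R .vert i (put R .vert (i + 1) (put R .vert i F)) =
      (vA * vB) • (put R .vert (i + 1) F - put R .vert i F
        + put R .vert i (put R .cup (i + 1) (put R .cap (i + 1) F))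
        - put R .vert (i + 1) (put R .cup i (put R .cap i F))
        + put R .cup (i + 1) (put R .cap (i + 1) (put R .vert i F))
        - put R .cup i (put R .cap i (put R .vert (i + 1) F)))
      + genericParams.δ • (put R .cup i (put R .cap i F)
        - put R .cup (i + 1) (put R .cap (i + 1) F)) := by
  refine eq_of_vec
    (f := put R .vert (i + 1) ∘ₗ put R .vert i ∘ₗ put R .vert (i + 1)
      - put R .vert i ∘ₗ put R .vert (i + 1) ∘ₗ put R .vert i)
    (g := (vA * vB) • (put R .vert (i + 1) - put R .vert i
        + put R .vert i ∘ₗ put R .cup (i + 1) ∘ₗ put R .cap (i + 1)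
        - put R .vert (i + 1) ∘ₗ put R .cup i ∘ₗ put R .cap i
        + put R .cup (i + 1) ∘ₗ put R .cap (i + 1) ∘ₗ put R .vert i
        - put R .cup i ∘ₗ put R .cap i ∘ₗ put R .vert (i + 1))
      + genericParams.δ • (put R .cup i ∘ₗ put R .cap i
        - put R .cup (i + 1) ∘ₗ put R .cap (i + 1))) (fun u v hu => ?_) hF
  obtain ⟨r, rfl⟩ : ∃ r, m = i + 3 + r := ⟨m - (i + 3), by omega⟩
  let f (w : List Slice) : R := vec P u (w.map (Slice.shift i) ++ v)
  change f (c₂ ++ (c₁ ++ c₂)) - f (c₁ ++ (c₂ ++ c₁)) =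
    (vA * vB) • (f c₂ - f c₁ + f (t₂ ++ c₁) - f (t₁ ++ c₂) + f (c₁ ++ t₂) - f (c₂ ++ t₁))
      + cδ • (f t₁ - f t₂)
  by_cases hv : Fits (i + 3 + r) v 2
  · have hf : ∀ w (hw : Fits 3 w 3), f w = P ((closeContext hu hv).diagram ⟨w, hw⟩) :=
      fun w hw => vec_of_context hu hv ⟨w, hw⟩
    rw [hf _ (fits_c₂.append (fits_c₁.append fits_c₂)),
      hf _ (fits_c₁.append (fits_c₂.append fits_c₁)), hf _ fits_c₂, hf _ fits_c₁,
      hf _ (fits_t₂.append fits_c₁), hf _ (fits_t₁.append fits_c₂),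
      hf _ (fits_c₁.append fits_t₂), hf _ (fits_c₂.append fits_t₁), hf _ fits_t₁, hf _ fits_t₂,
      Algebra.smul_def, Algebra.smul_def, hP.triple]
  · have hf : ∀ w (_ : Fits 3 w 3), f w = 0 := fun w hw => vec_of_not_fits hu ⟨w, hw⟩ hv
    rw [hf _ (fits_c₂.append (fits_c₁.append fits_c₂)),
      hf _ (fits_c₁.append (fits_c₂.append fits_c₁)), hf _ fits_c₂, hf _ fits_c₁,
      hf _ (fits_t₂.append fits_c₁), hf _ (fits_t₁.append fits_c₂),
      hf _ (fits_c₁.append fits_t₂), hf _ (fits_c₂.append fits_t₁), hf _ fits_t₁, hf _ fits_t₂,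
      Algebra.smul_def, Algebra.smul_def]
    simp

/-- The diagrams with free upper endpoints, paired with their complements by `P`. -/
def skeinModule (hP : GraphSkein (algebraMap Coeff R) P) :
    SkeinModule genericParams (List Slice → R) where
  U := vecSpan P
  empty := vec P []
  cup := put R .cup
  cap := put R .cap
  c := put R .vert
  empty_mem := vec_mem rfl
  cup_mem := put_cup_mem
  cap_mem := put_cap_mem
  c_mem := put_vert_mem
  cup_cup {m i j F} hF hij h := by
    obtain ⟨l, rfl⟩ := Nat.exists_eq_add_of_le hij
    rw [show i + l + 2 = i + 2 + l by omega]
    exact (put_exchange .cup .cup l hF (by simp only [Piece.ins]; omega)).symm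
  cap_cup {m i j F} hF hij h := by
    obtain ⟨l, rfl⟩ := Nat.exists_eq_add_of_le hij
    rw [show i + l + 2 = i + 2 + l by omega]
    exact put_exchange .cup .cap l hF (by simp only [Piece.ins]; omega)
  cap_cup' {m i j F} hF hij h := by
    obtain ⟨l, rfl⟩ := Nat.exists_eq_add_of_le hij
    rw [show i + l + 2 = i + 2 + l by omega]
    exact (put_exchange .cap .cup l hF (by simp only [Piece.ins]; omega)).symm
  cap_cap {m i j F} hF hij h := by
    obtain ⟨l, rfl⟩ := Nat.exists_eq_add_of_le hij
    rw [show i + l + 2 = i + 2 + l by omega]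
    exact (put_exchange .cap .cap l hF (by simp only [Piece.ins]; omega)).symm
  c_cup {m i j F} hF hij h := by
    obtain ⟨l, rfl⟩ := Nat.exists_eq_add_of_le hij
    rw [show i + l + 2 = i + 2 + l by omega]
    exact put_exchange .cup .vert l hF (by simp only [Piece.ins]; omega)
  c_cup' {m i j F} hF hij h := by
    obtain ⟨l, rfl⟩ := Nat.exists_eq_add_of_le hij
    exact (put_exchange .vert .cup l hF (by simp only [Piece.ins]; omega)).symm
  c_cap {m i j F} hF hij h := by
    obtain ⟨l, rfl⟩ := Nat.exists_eq_add_of_le hij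
    rw [show i + l + 2 = i + 2 + l by omega]
    exact (put_exchange .cap .vert l hF (by simp only [Piece.ins]; omega)).symm
  c_cap' {m i j F} hF hij h := by
    obtain ⟨l, rfl⟩ := Nat.exists_eq_add_of_le hij
    exact put_exchange .vert .cap l hF (by simp only [Piece.ins]; omega)
  c_c {m i j F} hF hij h := by
    obtain ⟨l, rfl⟩ := Nat.exists_eq_add_of_le hij
    exact (put_exchange .vert .vert l hF (by simp only [Piece.ins]; omega)).symm
  zigzag := put_zigzag_right
  zigzag' := put_zigzag_left
  cap_turn hF h := by rw [put_cap_vert hF h, hP.put_flip hF (by omega)]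
  cup_turn {m i F} hF h := by
    rw [put_cup_vert hF h, hP.put_flip (put_cup_mem hF (by omega)) (by omega)]
  circle := hP.put_circle
  bypass := hP.put_bypass
  digon := hP.put_digon
  triple := hP.put_triple

theorem vec_mem_S (hP : GraphSkein (algebraMap Coeff R) P)
    (u : List Slice) : ∀ {m}, Fits 0 u m → vec P u ∈ hP.skeinModule.S m := by
  induction u using List.reverseRecOn with
  | nil =>
    rintro m rfl
    exact Submodule.mem_span_singleton_self _
  | append_singleton u s ih =>
    intro m h
    obtain ⟨n, hn, hs, rfl⟩ : ∃ n, Fits 0 u n ∧ s.left + s.piece.ins ≤ n ∧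
        n - s.piece.ins + s.piece.outs = m := by
      clear ih
      generalize 0 = l at h ⊢
      induction u generalizing l with
      | nil => exact ⟨l, rfl, h⟩
      | cons t u ih =>
        obtain ⟨n, hn, hs⟩ := ih _ h.2
        exact ⟨n, ⟨h.1, hn⟩, hs⟩
    obtain ⟨x, i⟩ := s
    have hu := ih hn
    rw [← put_vec]
    cases x with
    | cup => exact hP.skeinModule.cup_mem_S hu hs
    | cap =>
      simp only [Piece.ins] at hs
      obtain ⟨n, rfl⟩ : ∃ l, n = l + 2 := ⟨n - 2, by omega⟩
      simp only [Piece.ins, Piece.outs, Nat.add_sub_cancel, Nat.add_zero]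
      exact hP.skeinModule.cap_mem_S hu (by omega)
    | vert =>
      simp only [Piece.ins] at hs
      simp only [Piece.ins, Piece.outs, Nat.sub_add_cancel (show 2 ≤ n by omega)]
      exact hP.skeinModule.c_mem_S hu hs
    | horiz =>
      simp only [Piece.ins] at hs
      simp only [Piece.ins, Piece.outs, Nat.sub_add_cancel (show 2 ≤ n by omega)]
      rw [hP.put_flip (vec_mem hn) hs]
      exact hP.skeinModule.c_mem_S hu hs

end GraphSkein

/-- The skein relations determine the value of a diagram: it comes from the generic coefficient
ring. -/
theorem GraphSkein.mem_range {R : Type*} [CommRing R] {φ : Coeff →+* R} {P : Diagram → R}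
    (hP : GraphSkein φ P) (D : Diagram) : ∃ x, P D = φ x := by
  let _ := φ.toAlgebra
  change GraphSkein (algebraMap Coeff R) P at hP
  obtain ⟨⟨⟨w, hw⟩, hne⟩, rfl⟩ := Quot.exists_rep D
  obtain ⟨u, hu, rfl⟩ := hw.exists_cap hne
  obtain ⟨x, hx⟩ := hP.skeinModule.exists_eq_smul_cup (hP.vec_mem_S u hu)
  refine ⟨x, ?_⟩
  have h₁ := congrFun hx []
  have h₂ : hP.skeinModule.cup 0 hP.skeinModule.empty [] = P PlanarTrivalent.unknot := by
    change vec P [] [⟨.cup, 0⟩] = _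
    rw [vec, closeValue, dif_pos (by simp [Fits, Piece.ins, Piece.outs])]
    exact congrArg P (Diagram.mk_congr rfl)
  rw [Pi.smul_apply, h₂, hP.unknot, Algebra.smul_def, mul_one] at h₁
  rw [← show _ = φ x from h₁, vec, closeValue, dif_pos (by simpa using hu)]
  exact congrArg P (Diagram.mk_congr (by simp))

/-! ### Solutions of the Yang–Baxter equation -/

/-- An orthogonal solution of the Yang–Baxter equation on the vector space with basis `I`, with
parameters `s` and `a`. All operators act on functions of labels, so that a piece of a diagram maps
functions of its upper labels to functions of its lower labels. A minimum acts by `cup`, a maximum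
by multiplication with `cap`, and the positive crossing by `σ`. -/
structure YangBaxter {K : Type*} [Field K] (s a : K) (I : Type*) where
  cap : I → I → K
  cup : (I → I → K) →ₗ[K] K
  σ : (I → I → K) →ₗ[K] (I → I → K)
  zigzag : ∀ (g : I → K) i, cup (fun j k => cap i j * g k) = g i
  zigzag' : ∀ (g : I → K) i, cup (fun j k => cap k i * g j) = g i
  circle : (s - s⁻¹) * cup cap = a - a⁻¹ + (s - s⁻¹)
  σ_cap : ∀ i j, σ cap i j = a⁻¹ * cap i j
  cup_σ : ∀ g, cup (σ g) = a⁻¹ * cup g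
  σ_σ : ∀ g i j, σ (σ g) i j =
    g i j + (s - s⁻¹) * σ g i j - (s - s⁻¹) * a⁻¹ * cup g * cap i j
  cap_turn : ∀ (g : I → K) i j k, σ (fun j k => cap i j * g k) j k =
    σ (fun i j => cap j k * g i) i j - (s - s⁻¹) * (cap j k * g i)
      + (s - s⁻¹) * (cap i j * g k)
  cup_turn : ∀ (g : I → I → I → K) k, cup (fun i j => σ (g i) j k) =
    cup (fun i j => σ (fun i' j' => g i' j' j) k i) - (s - s⁻¹) * cup (g k)
      + (s - s⁻¹) * cup (fun i j => g i j k)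
  braid : ∀ (g : I → I → I → K) i j k,
    σ (fun i j => σ (fun j k => σ (fun i j => g i j k) i j) j k) i j =
      σ (fun j k => σ (fun i j => σ (fun j k => g i j k) j k) i j) j k

namespace YangBaxter

variable {K : Type*} [Field K] {s a : K} {I : Type*} (D : YangBaxter s a I)

section Linear

variable (x y : I → I → K) (r : K) (i j : I)

theorem cup_add : D.cup (fun i j => x i j + y i j) =
    D.cup (fun i j => x i j) + D.cup (fun i j => y i j) := map_add D.cup x y

theorem cup_sub : D.cup (fun i j => x i j - y i j) =
    D.cup (fun i j => x i j) - D.cup (fun i j => y i j) := map_sub D.cup x y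

theorem cup_mul : D.cup (fun i j => r * x i j) = r * D.cup (fun i j => x i j) :=
  map_smul D.cup r x

theorem σ_add : D.σ (fun i j => x i j + y i j) i j =
    D.σ (fun i j => x i j) i j + D.σ (fun i j => y i j) i j :=
  congrFun (congrFun (map_add D.σ x y) i) j

theorem σ_sub : D.σ (fun i j => x i j - y i j) i j =
    D.σ (fun i j => x i j) i j - D.σ (fun i j => y i j) i j :=
  congrFun (congrFun (map_sub D.σ x y) i) j

theorem σ_mul : D.σ (fun i j => r * x i j) i j = r * D.σ (fun i j => x i j) i j :=
  congrFun (congrFun (map_smul D.σ r x) i) j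

theorem cup_zero : D.cup (fun _ _ => 0) = 0 := map_zero D.cup

theorem σ_zero : D.σ (fun _ _ => 0) i j = 0 := congrFun (congrFun (map_zero D.σ) i) j

theorem cup_cap_mul : D.cup (fun i j => D.cap i j * r) = D.cup D.cap * r := by
  simpa only [mul_comm] using D.cup_mul D.cap r

theorem σ_cap_mul : D.σ (fun i j => D.cap i j * r) i j = a⁻¹ * (D.cap i j * r) := by
  have h := D.σ_mul D.cap r i j
  simp only [mul_comm r] at h
  rw [h, D.σ_cap, mul_assoc]

theorem circle_mul : (s - s⁻¹) * (D.cup D.cap * r) = (a - a⁻¹ + (s - s⁻¹)) * r := by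
  rw [← mul_assoc, D.circle]

theorem cup_σ' : D.cup (fun i j => D.σ (fun i j => x i j) i j) = a⁻¹ * D.cup (fun i j => x i j) :=
  D.cup_σ x

theorem σ_σ' : D.σ (fun i j => D.σ (fun i j => x i j) i j) i j =
    x i j + (s - s⁻¹) * D.σ (fun i j => x i j) i j
      - (s - s⁻¹) * (a⁻¹ * (D.cap i j * D.cup (fun i j => x i j))) := by
  rw [show D.σ (fun i j => D.σ (fun i j => x i j) i j) i j = _ from D.σ_σ x i j]
  ring

end Linear

/-! #### Sliding under a strand -/

theorem cup_turn' (g : I → I → I → K) (k : I) :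
    D.cup (fun i j => D.σ (fun j k => g i j k) j k) =
      D.cup (fun i j => D.σ (fun i j' => g i j' j) k i) - (s - s⁻¹) * D.cup (fun i j => g k i j)
        + (s - s⁻¹) * D.cup (fun i j => g i j k) := D.cup_turn g k

/-- A minimum slides under a strand. -/
theorem cup_σ_σ (g : I → I → I → K) (k : I) :
    D.cup (fun i j => D.σ (fun j k => D.σ (fun i j => g i j k) i j) j k) =
      D.cup (fun i j => g k i j) := by
  simp only [D.cup_turn' fun i j k => D.σ (fun i j => g i j k) i j, σ_σ', cup_σ', cup_add,
    cup_sub, cup_mul, D.zigzag]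
  ring

theorem cup_σ_σ_left (g : I → I → I → K) (k : I) :
    D.cup (fun i j => D.σ (fun i j' => D.σ (fun j k => g i j k) j' j) k i) =
      D.cup (fun i j => g i j k) := by
  have h := D.cup_turn' (fun i j k => D.σ (fun j k => g i j k) j k) k
  simp only [σ_σ', cup_σ', cup_add, cup_sub, cup_mul, D.zigzag'] at h
  linear_combination -h

theorem cup_σ_cap (g : I → K) (k : I) :
    D.cup (fun i j => D.σ (fun j k => D.cap i j * g k) j k) = a * g k := by
  simp only [D.cup_turn' fun i j k => D.cap i j * g k, σ_cap_mul, cup_mul, cup_cap_mul,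
    circle_mul, D.zigzag]
  ring

theorem cup_σ_cap_left (g : I → K) (k : I) :
    D.cup (fun i j => D.σ (fun i j' => D.cap j' j * g i) k i) = a * g k := by
  have h := D.cup_turn' (fun i j k => D.cap j k * g i) k
  simp only [σ_cap_mul, cup_mul, cup_cap_mul, circle_mul, D.zigzag'] at h
  linear_combination -h

/-- A maximum slides under a strand. -/
theorem σ_σ_cap (g : I → K) (i j k : I) :
    D.σ (fun i j => D.σ (fun j k => D.cap i j * g k) j k) i j = D.cap j k * g i := by
  simp only [D.cap_turn, σ_add, σ_sub, σ_mul, σ_σ', σ_cap_mul, D.zigzag']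
  ring

theorem σ_σ_cap_left (g : I → K) (i j k : I) :
    D.σ (fun j k => D.σ (fun i j => D.cap j k * g i) i j) j k = D.cap i j * g k := by
  have h i j k : D.σ (fun i j => D.cap j k * g i) i j = D.σ (fun j k => D.cap i j * g k) j k
      + (s - s⁻¹) * (D.cap j k * g i) - (s - s⁻¹) * (D.cap i j * g k) := by
    rw [D.cap_turn]
    ring
  simp only [h, σ_add, σ_sub, σ_mul, σ_σ', σ_cap_mul, D.zigzag]
  ring

end YangBaxter

/-! #### Adding a hyperbolic plane -/

/-- Labels for a vector space with a hyperbolic plane added. -/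
inductive Lab (I : Type*)
  | pos
  | mid (i : I)
  | neg

namespace YangBaxter

variable {K : Type*} [Field K]

/-- The solution on the zero space. -/
def zero (s : K) : YangBaxter s s⁻¹ Empty where
  cap := fun i => i.elim
  cup := 0
  σ := 0
  zigzag _ i := i.elim
  zigzag' _ i := i.elim
  circle := by
    rw [LinearMap.zero_apply, inv_inv]
    ring
  σ_cap i := i.elim
  cup_σ _ := by simp
  σ_σ _ i := i.elim
  cap_turn _ i := i.elim
  cup_turn _ i := i.elim
  braid _ i := i.elim

variable {s a : K} {I : Type*} (D : YangBaxter s a I)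

/-- The maximum after adding a hyperbolic plane. -/
def capStep : Lab I → Lab I → K
  | .pos, .neg => (a * s)⁻¹
  | .neg, .pos => 1
  | .mid i, .mid j => D.cap i j
  | _, _ => 0

/-- The minimum after adding a hyperbolic plane. -/
def cupStep : (Lab I → Lab I → K) →ₗ[K] K where
  toFun g := g .pos .neg + a * s * g .neg .pos + D.cup fun i j => g (.mid i) (.mid j)
  map_add' f g := by
    simp only [Pi.add_apply, cup_add]
    ring
  map_smul' r f := by
    simp only [Pi.smul_apply, smul_eq_mul, cup_mul, RingHom.id_apply]
    ring

/-- The values of the positive crossing after adding a hyperbolic plane: the orthogonal `R`-matrix,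
with the new basis vectors `pos` and `neg` placed before and after the old ones. -/
def σFun (g : Lab I → Lab I → K) : Lab I → Lab I → K
  | .pos, .pos => s * g .pos .pos
  | .neg, .neg => s * g .neg .neg
  | .pos, .mid v => g (.mid v) .pos + (s - s⁻¹) * g .pos (.mid v)
  | .mid v, .pos => g .pos (.mid v)
  | .mid v, .neg => g .neg (.mid v) + (s - s⁻¹) * g (.mid v) .neg
  | .neg, .mid v => g (.mid v) .neg
  | .pos, .neg => s⁻¹ * g .neg .pos + (s - s⁻¹) * ((1 - (a * s)⁻¹) * g .pos .neg)
      - (s - s⁻¹) * ((a * s)⁻¹ * D.cup fun i j => g (.mid i) (.mid j))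
  | .neg, .pos => s⁻¹ * g .pos .neg
  | .mid v, .mid w => D.σ (fun i j => g (.mid i) (.mid j)) v w
      - (s - s⁻¹) * (D.cap v w * g .pos .neg)

/-- The positive crossing after adding a hyperbolic plane, as a linear map. -/
def σStep : (Lab I → Lab I → K) →ₗ[K] (Lab I → Lab I → K) where
  toFun := D.σFun
  map_add' f g := by
    funext x y
    cases x <;> cases y <;> simp only [Pi.add_apply, σFun, cup_add, σ_add] <;> ring
  map_smul' r f := by
    funext x y
    cases x <;> cases y <;>
      simp only [Pi.smul_apply, smul_eq_mul, σFun, cup_mul, σ_mul, RingHom.id_apply] <;> ring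

theorem cupStep_apply (g : Lab I → Lab I → K) : D.cupStep g =
    g .pos .neg + a * s * g .neg .pos + D.cup fun i j => g (.mid i) (.mid j) := rfl

theorem σStep_apply (g : Lab I → Lab I → K) : D.σStep g = D.σFun g := rfl

theorem cap_mul_add (x y : K) (i j : I) :
    D.cap i j * (x + y) = D.cap i j * x + D.cap i j * y := mul_add _ _ _

theorem cap_mul_sub (x y : K) (i j : I) :
    D.cap i j * (x - y) = D.cap i j * x - D.cap i j * y := mul_sub _ _ _

theorem cap_mul_mul (x y : K) (i j : I) :
    D.cap i j * (x * y) = x * (D.cap i j * y) := mul_left_comm _ _ _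

theorem zigzag_step (hs : s ≠ 0) (ha : a ≠ 0) (g : Lab I → K) (i : Lab I) :
    D.cupStep (fun j k => D.capStep i j * g k) = g i := by
  cases i <;> simp [cupStep_apply, capStep, D.zigzag, cup_zero]
  field_simp

theorem zigzag_step' (hs : s ≠ 0) (ha : a ≠ 0) (g : Lab I → K) (i : Lab I) :
    D.cupStep (fun j k => D.capStep k i * g j) = g i := by
  cases i <;> simp [cupStep_apply, capStep, D.zigzag', cup_zero]
  field_simp

theorem circle_step (hs : s ≠ 0) (ha : a ≠ 0) :
    (s - s⁻¹) * D.cupStep D.capStep = a * s ^ 2 - (a * s ^ 2)⁻¹ + (s - s⁻¹) := by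
  simp only [cupStep_apply, capStep]
  rw [mul_add, D.circle]
  field_simp
  ring

theorem σ_cap_step (hs : s ≠ 0) (ha : a ≠ 0) (i j : Lab I) :
    D.σStep D.capStep i j = (a * s ^ 2)⁻¹ * D.capStep i j := by
  have hc := D.circle
  have hσ (i j : I) : D.σ (fun i j => D.cap i j) i j = a⁻¹ * D.cap i j := D.σ_cap i j
  have he : D.cup (fun i j => D.cap i j) = D.cup D.cap := rfl
  cases i <;> cases j <;> simp only [σStep_apply, σFun, capStep, hσ, he, mul_zero, add_zero]
  case pos.neg =>
    -- Both sides involve the value of the circle.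
    field_simp at hc ⊢
    linear_combination -s * hc
  all_goals
    field_simp
    try ring

theorem cup_σ_step (hs : s ≠ 0) (ha : a ≠ 0) (g : Lab I → Lab I → K) :
    D.cupStep (D.σStep g) = (a * s ^ 2)⁻¹ * D.cupStep g := by
  simp only [cupStep_apply, σStep_apply, σFun, cup_sub, cup_mul, cup_cap_mul, circle_mul, cup_σ']
  field_simp
  ring

theorem σ_σ_step (hs : s ≠ 0) (ha : a ≠ 0) (g : Lab I → Lab I → K) (i j : Lab I) :
    D.σStep (D.σStep g) i j = g i j + (s - s⁻¹) * D.σStep g i j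
      - (s - s⁻¹) * (a * s ^ 2)⁻¹ * D.cupStep g * D.capStep i j := by
  cases i <;> cases j <;> simp only [cupStep_apply, σStep_apply, σFun, cup_sub, cup_mul,
    capStep, σ_sub, σ_mul, cup_σ', σ_σ', cup_cap_mul, σ_cap_mul, circle_mul]
  all_goals
    field_simp
    ring

theorem cap_turn_step (g : Lab I → K) (i j k : Lab I) :
    D.σStep (fun j k => D.capStep i j * g k) j k =
      D.σStep (fun i j => D.capStep j k * g i) i j - (s - s⁻¹) * (D.capStep j k * g i)
        + (s - s⁻¹) * (D.capStep i j * g k) := by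
  cases i <;> cases j <;> cases k <;> simp only [σStep_apply, σFun, capStep, D.zigzag, D.zigzag',
    D.cap_turn, zero_mul, mul_zero, cup_zero, σ_zero]
  all_goals ring1

theorem cup_turn_step (hs : s ≠ 0) (ha : a ≠ 0) (g : Lab I → Lab I → Lab I → K) (k : Lab I) :
    D.cupStep (fun i j => D.σStep (g i) j k) =
      D.cupStep (fun i j => D.σStep (fun i' j' => g i' j' j) k i) - (s - s⁻¹) * D.cupStep (g k)
        + (s - s⁻¹) * D.cupStep (fun i j => g i j k) := by
  cases k <;> simp only [cupStep_apply, σStep_apply, σFun, cup_sub, cup_mul, cup_add, D.cup_turn',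
    D.zigzag, D.zigzag']
  all_goals
    field_simp
    ring

theorem braid_step_pos (hs : s ≠ 0) (ha : a ≠ 0) (g : Lab I → Lab I → Lab I → K) (j k : Lab I) :
    D.σStep (fun i j => D.σStep (fun j k => D.σStep (fun i j => g i j k) i j) j k) .pos j =
      D.σStep (fun j k => D.σStep (fun i j => D.σStep (fun j k => g i j k) j k) .pos j) j k := by
  cases j <;> cases k <;> simp only [σStep_apply, σFun, cup_sub, cup_mul, cup_add, σ_add,
    σ_sub, σ_mul, cup_cap_mul, σ_cap_mul, cap_mul_add, cap_mul_sub, cap_mul_mul, D.zigzag,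
    D.zigzag', circle_mul, cup_σ_σ, cup_σ_cap, cup_σ', σ_σ']
  case mid.neg =>
    rw [D.cup_turn' fun i j k => g (.mid i) (.mid j) (.mid k)]
    field_simp
    ring
  all_goals first | ring1 | (field_simp; done) | (field_simp; ring1)

theorem braid_step_mid (hs : s ≠ 0) (ha : a ≠ 0) (g : Lab I → Lab I → Lab I → K) (i : I)
    (j k : Lab I) :
    D.σStep (fun i j => D.σStep (fun j k => D.σStep (fun i j => g i j k) i j) j k) (.mid i) j =
      D.σStep (fun j k =>
        D.σStep (fun i j => D.σStep (fun j k => g i j k) j k) (.mid i) j) j k := by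
  cases j <;> cases k <;> simp only [σStep_apply, σFun, cup_sub, cup_mul, σ_add, σ_sub,
    σ_mul, D.braid, σ_cap_mul, cap_mul_add, cap_mul_sub, cap_mul_mul, D.zigzag, cup_σ_σ_left,
    cup_σ_cap_left, σ_σ_cap, σ_σ_cap_left, σ_σ']
  case mid.mid =>
    rw [D.cap_turn (fun j => g .pos (.mid j) .neg)]
    ring
  all_goals first | ring1 | (field_simp; done) | (field_simp; ring1)

theorem braid_step_neg (hs : s ≠ 0) (ha : a ≠ 0) (g : Lab I → Lab I → Lab I → K) (j k : Lab I) :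
    D.σStep (fun i j => D.σStep (fun j k => D.σStep (fun i j => g i j k) i j) j k) .neg j =
      D.σStep (fun j k => D.σStep (fun i j => D.σStep (fun j k => g i j k) j k) .neg j) j k := by
  cases j <;> cases k <;> simp only [σStep_apply, σFun, cap_mul_mul]
  all_goals first | ring1 | field_simp

/-- A hyperbolic plane can be added to a solution; this multiplies `a` by `s ^ 2`. -/
def step (hs : s ≠ 0) (ha : a ≠ 0) : YangBaxter s (a * s ^ 2) (Lab I) where
  cap := D.capStep
  cup := D.cupStep
  σ := D.σStep
  zigzag := D.zigzag_step hs ha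
  zigzag' := D.zigzag_step' hs ha
  circle := D.circle_step hs ha
  σ_cap := D.σ_cap_step hs ha
  cup_σ := D.cup_σ_step hs ha
  σ_σ := D.σ_σ_step hs ha
  cap_turn := D.cap_turn_step
  cup_turn := D.cup_turn_step hs ha
  braid g i j k := by
    cases i with
    | pos => exact D.braid_step_pos hs ha g j k
    | mid i => exact D.braid_step_mid hs ha g i j k
    | neg => exact D.braid_step_neg hs ha g j k

end YangBaxter

instance {I : Type*} [Finite I] : Finite (Lab I) :=
  Finite.of_injective (β := Option (Option I))
    (fun | .pos => none | .neg => some none | .mid i => some (some i))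
    (by rintro (_ | _ | _) (_ | _ | _) h <;> simp_all)

/-- The solutions attached to the orthogonal spaces of even dimension. -/
theorem exists_yangBaxter {K : Type*} [Field K] {s : K} (hs : s ≠ 0) (n : ℕ) :
    ∃ I : Type, Finite I ∧ Nonempty (YangBaxter s (s⁻¹ * (s ^ 2) ^ n) I) := by
  induction n with
  | zero => exact ⟨Empty, inferInstance, ⟨by simpa using YangBaxter.zero s⟩⟩
  | succ n ih =>
    obtain ⟨I, hI, ⟨D⟩⟩ := ih
    refine ⟨Lab I, inferInstance, ⟨?_⟩⟩
    rw [pow_succ, ← mul_assoc]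
    exact D.step hs (by simp [hs])

/-! ### Graph polynomials from solutions of the Yang–Baxter equation -/

namespace YangBaxter

variable {K : Type*} [Field K] (q : Params K) {s : K} {I : Type*} (D : YangBaxter s q.a I)

/-- The turn-back as an operator. -/
def turn : Module.End K (I → I → K) where
  toFun g i j := D.cap i j * D.cup g
  map_add' f g := by
    funext i j
    simp [mul_add]
  map_smul' r f := by
    funext i j
    simp [mul_left_comm]

/-- The wide edge as an operator, obtained from the crossing `A + B t + c`. -/
def wide : Module.End K (I → I → K) := D.σ - q.A • (1 : Module.End K (I → I → K)) - q.B • turn q D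

variable {q}

theorem wide_apply (g : I → I → K) (i j : I) :
    wide q D g i j = D.σ g i j - q.A * g i j - q.B * (D.cap i j * D.cup g) := rfl

theorem crossing_wide : q.crossing (wide q D) (turn q D) = D.σ := by
  simp only [Params.crossing, wide]
  abel

theorem a_inv : q.a⁻¹ = q.aInv := inv_eq_of_mul_eq_one_right q.a_mul_aInv

section TwoStrands

variable (hs : q.A - q.B = s - s⁻¹)
include hs

theorem cup_cap : D.cup D.cap = q.α := by
  have h := D.circle
  rw [← hs, a_inv] at h
  rw [Params.α]
  linear_combination q.zInv * h - (D.cup D.cap - 1) * q.sub_mul_zInv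

theorem turn_mul_turn : turn q D * turn q D = q.α • turn q D := by
  ext1 g
  funext i j
  have h := D.cup_cap_mul (D.cup g)
  change D.cap i j * D.cup (fun i j => D.cap i j * D.cup g) = q.α * (D.cap i j * D.cup g)
  rw [h, D.cup_cap hs]
  ring

theorem wide_mul_turn : wide q D * turn q D = q.β • turn q D := by
  ext1 g
  funext i j
  change D.σ (fun i j => D.cap i j * D.cup g) i j - q.A * (D.cap i j * D.cup g)
    - q.B * (D.cap i j * D.cup (fun i j => D.cap i j * D.cup g)) = q.β * (D.cap i j * D.cup g)
  rw [D.σ_cap_mul, D.cup_cap_mul, D.cup_cap hs, a_inv, ← q.curl_eq]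
  ring

theorem cup_wide (g : I → I → K) : D.cup (wide q D g) = q.β * D.cup g := by
  have h : wide q D g = fun i j => D.σ g i j - q.A * g i j - q.B * (D.cap i j * D.cup g) := rfl
  rw [h, cup_sub, cup_sub, cup_mul, cup_mul, cup_cap_mul, D.cup_cap hs,
    show D.cup (fun i j => D.σ g i j) = _ from D.cup_σ g, a_inv, ← q.curl_eq]
  ring

theorem turn_mul_wide : turn q D * wide q D = q.β • turn q D := by
  ext1 g
  funext i j
  change D.cap i j * D.cup (wide q D g) = q.β * (D.cap i j * D.cup g)
  rw [D.cup_wide hs]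
  ring

theorem wide_mul_wide : wide q D * wide q D =
    (1 - q.A * q.B) • 1 + q.γ • turn q D - (q.A + q.B) • wide q D := by
  refine q.digon_of_crossing (D.turn_mul_turn hs) (D.turn_mul_wide hs) (D.wide_mul_turn hs) ?_
  have h : q.crossingInv (wide q D) (turn q D) =
      D.σ - (q.A - q.B) • (1 : Module.End K (I → I → K)) + (q.A - q.B) • turn q D := by
    rw [← D.crossing_wide, Params.crossing, Params.crossingInv]
    module
  have ht : (D.σ : Module.End K (I → I → K)) * turn q D = q.aInv • turn q D := by
    ext1 g
    funext i j
    change D.σ (fun i j => D.cap i j * D.cup g) i j = q.aInv * (D.cap i j * D.cup g)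
    rw [D.σ_cap_mul, a_inv]
  have hσ : (D.σ : Module.End K (I → I → K)) * D.σ =
      1 + (q.A - q.B) • D.σ - (q.A - q.B) • q.aInv • turn q D := by
    ext1 g
    funext i j
    change D.σ (D.σ g) i j =
      g i j + (q.A - q.B) * D.σ g i j - (q.A - q.B) * (q.aInv * (D.cap i j * D.cup g))
    rw [D.σ_σ, hs, a_inv]
    ring
  rw [crossing_wide, h, mul_add, mul_sub, mul_smul_comm, mul_smul_comm, mul_one, ht, hσ]
  module

/-- A maximum slides past a wide edge, which makes a quarter turn. -/
theorem wide_cap (g : I → K) (i j k : I) :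
    wide q D (fun j k => D.cap i j * g k) j k = wide q D (fun i j => D.cap j k * g i) i j := by
  rw [wide_apply, wide_apply, D.cap_turn, D.zigzag, D.zigzag', ← hs]
  ring

/-- A minimum slides past a wide edge, which makes a quarter turn. -/
theorem cup_wide_turn (g : I → I → I → K) (k : I) :
    D.cup (fun i j => wide q D (fun j k => g i j k) j k) =
      D.cup (fun i j => wide q D (fun i' j' => g i' j' j) k i) := by
  simp only [wide_apply, cup_sub, cup_mul, D.zigzag, D.zigzag', D.cup_turn', ← hs]
  ring

theorem cup_wide_cap (g : I → K) (i : I) :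
    D.cup (fun j k => wide q D (fun i j => D.cap j k * g i) i j) = q.β * g i := by
  simp only [← D.wide_cap hs]
  rw [show D.cup (fun j k => wide q D (fun j k => D.cap i j * g k) j k) = _ from
    D.cup_wide hs _, D.zigzag]

end TwoStrands

section ThreeStrands

/-- An operator on two strands, applied to the first two of three strands. -/
def liftLeft (X : Module.End K (I → I → K)) : Module.End K (I → I → I → K) where
  toFun g i j k := X (fun i j => g i j k) i j
  map_add' f g := by
    funext i j k
    exact congrFun (congrFun (map_add X (fun i j => f i j k) (fun i j => g i j k)) i) j
  map_smul' r g := by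
    funext i j k
    exact congrFun (congrFun (map_smul X r (fun i j => g i j k)) i) j

/-- An operator on two strands, applied to the last two of three strands. -/
def liftRight (X : Module.End K (I → I → K)) : Module.End K (I → I → I → K) where
  toFun g i := X (g i)
  map_add' f g := by
    funext i
    exact map_add X (f i) (g i)
  map_smul' r g := by
    funext i
    exact map_smul X r (g i)

theorem triple_wide (hs : q.A - q.B = s - s⁻¹) {c₁ c₂ t₁ t₂ : Module.End K (I → I → I → K)}
    (hc₁ : c₁ = liftLeft (wide q D)) (hc₂ : c₂ = liftRight (wide q D))
    (ht₁ : t₁ = liftLeft (turn q D)) (ht₂ : t₂ = liftRight (turn q D)) :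
    c₂ * c₁ * c₂ - c₁ * c₂ * c₁ =
      (q.A * q.B) • (c₂ - c₁ + t₂ * c₁ - t₁ * c₂ + c₁ * t₂ - c₂ * t₁) + q.δ • (t₁ - t₂) := by
  have hσ₁ : q.crossing c₁ t₁ = liftLeft D.σ := by
    rw [← D.crossing_wide, hc₁, ht₁]
    rfl
  have hσ₂ : q.crossing c₂ t₂ = liftRight D.σ := by
    rw [← D.crossing_wide, hc₂, ht₂]
    rfl
  have h₁₂ (g : I → I → I → K) (i j k : I) :
      t₁ (t₂ g) i j k = D.cap i j * D.cup (fun i j => g k i j) := by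
    rw [ht₁, ht₂]
    change D.cap i j * D.cup (fun i j => D.cap j k * D.cup (g i)) = _
    rw [D.zigzag']
  have h₂₁ (g : I → I → I → K) (i j k : I) :
      t₂ (t₁ g) i j k = D.cap j k * D.cup (fun j k => g j k i) := by
    rw [ht₁, ht₂]
    change D.cap j k * D.cup (fun j k => D.cap i j * D.cup (fun i j => g i j k)) = _
    rw [D.zigzag]
  have key := q.braid_sub_braid (c₁ := c₁) (c₂ := c₂) (t₁ := t₁) (t₂ := t₂)
    (by rw [ht₁]; exact congrArg liftLeft (D.turn_mul_turn hs))
    (by rw [ht₂]; exact congrArg liftRight (D.turn_mul_turn hs))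
    (by
      ext1 g
      funext i j k
      change t₁ (t₂ (t₁ g)) i j k = _
      rw [h₁₂, ht₁]
      change D.cap i j * D.cup (fun i j => D.cap k i * D.cup (fun i' j' => g i' j' j)) = _
      rw [D.zigzag]
      rfl)
    (by
      ext1 g
      funext i j k
      change t₂ (t₁ (t₂ g)) i j k = _
      rw [h₂₁, ht₂]
      change D.cap j k * D.cup (fun j k => D.cap k i * D.cup (g j)) = _
      rw [D.zigzag']
      rfl)
    (by rw [ht₁, hc₁]; exact congrArg liftLeft (D.turn_mul_wide hs))
    (by rw [ht₁, hc₁]; exact congrArg liftLeft (D.wide_mul_turn hs))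
    (by rw [ht₂, hc₂]; exact congrArg liftRight (D.turn_mul_wide hs))
    (by rw [ht₂, hc₂]; exact congrArg liftRight (D.wide_mul_turn hs))
    (by rw [ht₁, hc₁]; exact congrArg liftLeft (D.wide_mul_wide hs))
    (by rw [ht₂, hc₂]; exact congrArg liftRight (D.wide_mul_wide hs))
    (by
      ext1 g
      funext i j k
      change _ = t₁ (t₂ (c₁ g)) i j k
      rw [h₁₂, hc₁, hc₂, ht₁]
      exact congrArg (D.cap i j * ·) (D.cup_wide_turn hs g k))
    (by
      ext1 g
      funext i j k
      change _ = t₂ (t₁ (c₂ g)) i j k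
      rw [h₂₁, hc₁, hc₂, ht₂]
      exact congrArg (D.cap j k * ·) (D.cup_wide_turn hs g i).symm)
    (by
      ext1 g
      funext i j k
      change _ = c₁ (t₂ (t₁ g)) i j k
      rw [funext fun i => funext fun j => funext fun k => h₂₁ g i j k, hc₁, hc₂, ht₁]
      exact D.wide_cap hs (fun k => D.cup (fun i j => g i j k)) i j k)
    (by
      ext1 g
      funext i j k
      change _ = c₂ (t₁ (t₂ g)) i j k
      rw [funext fun i => funext fun j => funext fun k => h₁₂ g i j k, hc₁, hc₂, ht₂]
      exact (D.wide_cap hs (fun i => D.cup (g i)) i j k).symm)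
  have hb : liftLeft D.σ * liftRight D.σ * liftLeft D.σ =
      liftRight D.σ * liftLeft D.σ * liftRight D.σ := by
    ext1 g
    funext i j k
    exact D.braid g i j k
  rw [hσ₁, hσ₂, hb, sub_self] at key
  linear_combination (norm := module) key

end ThreeStrands

/-! #### Evaluation of words -/

/-- An elementary piece as an operator on functions of the sequence of labels along a level. The
piece stands at the far left. -/
def actZero (x : Piece) : (List I → K) →ₗ[K] (List I → K) where
  toFun f u := match x, u with
    | .cup, u => D.cup fun i j => f (i :: j :: u)
    | .cap, i :: j :: u => D.cap i j * f u
    | .vert, i :: j :: u => wide q D (fun i j => f (i :: j :: u)) i j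
    | .horiz, i :: j :: u => wide q D (fun i j => f (i :: j :: u)) i j
    | _, _ => 0
  map_add' f g := by
    funext u
    rcases x with _ | _ | _ | _ <;> rcases u with _ | ⟨i, _ | ⟨j, u⟩⟩
    all_goals first
      | exact D.cup_add _ _
      | exact mul_add _ _ _
      | exact congrFun (congrFun (map_add (wide q D) _ _) _) _
      | exact (add_zero _).symm
  map_smul' r f := by
    funext u
    rcases x with _ | _ | _ | _ <;> rcases u with _ | ⟨i, _ | ⟨j, u⟩⟩
    all_goals first
      | exact D.cup_mul _ _
      | exact mul_left_comm _ _ _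
      | exact congrFun (congrFun (map_smul (wide q D) _ _) _) _
      | exact (mul_zero _).symm

/-- An elementary piece as an operator, with `l` strands to its left. -/
def act (x : Piece) : ℕ → (List I → K) →ₗ[K] (List I → K)
  | 0 => D.actZero x
  | l + 1 =>
    { toFun := fun f u => match u with
        | [] => 0
        | i :: u => act x l (fun v => f (i :: v)) u
      map_add' := fun f g => by
        funext u
        rcases u with _ | ⟨i, u⟩
        · exact (add_zero _).symm
        · exact congrFun (map_add (act x l) _ _) u
      map_smul' := fun r f => by
        funext u
        rcases u with _ | ⟨i, u⟩
        · exact (mul_zero _).symm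
        · exact congrFun (map_smul (act x l) _ _) u }

/-- A list of slices as an operator from functions of the labels on the upper level to functions of
the labels on the lower level. -/
def evalWord : List Slice → (List I → K) →ₗ[K] (List I → K)
  | [] => LinearMap.id
  | s :: w => D.act s.piece s.left ∘ₗ evalWord w

theorem act_succ (x : Piece) (l : ℕ) (f : List I → K) (i : I) (u : List I) :
    D.act x (l + 1) f (i :: u) = D.act x l (fun v => f (i :: v)) u := rfl

theorem evalWord_append (w w' : List Slice) (f : List I → K) :
    D.evalWord (w ++ w') f = D.evalWord w (D.evalWord w' f) := by
  induction w with
  | nil => rfl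
  | cons s w ih => exact congrArg (D.act s.piece s.left) ih

theorem evalWord_shift_succ (w : List Slice) (p : ℕ) (f : List I → K) (i : I) (u : List I) :
    D.evalWord (w.map (Slice.shift (p + 1))) f (i :: u) =
      D.evalWord (w.map (Slice.shift p)) (fun v => f (i :: v)) u := by
  induction w generalizing u with
  | nil => rfl
  | cons s w ih =>
    change D.act s.piece (p + 1 + s.left) _ (i :: u) = D.act s.piece (p + s.left) _ u
    rw [add_right_comm, act_succ]
    exact congrFun (congrArg (D.act s.piece (p + s.left)) (funext ih)) u

theorem evalWord_shift_zero (w : List Slice) (f : List I → K) :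
    D.evalWord (w.map (Slice.shift 0)) f = D.evalWord w f := by
  have h : Slice.shift 0 = id := by
    funext s
    simp [Slice.shift]
  rw [h, List.map_id]

/-- A local linear relation remains true with more strands on the left. -/
theorem relation_shift {k : ℕ} (L : List (K × List Slice))
    (h : ∀ (f : List I → K) u, k ≤ u.length →
      (L.map fun t => t.1 * D.evalWord t.2 f u).sum = 0) (p : ℕ) :
    ∀ (f : List I → K) u, p + k ≤ u.length →
      (L.map fun t => t.1 * D.evalWord (t.2.map (Slice.shift p)) f u).sum = 0 := by
  induction p with
  | zero =>
    intro f u hu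
    simpa only [evalWord_shift_zero] using h f u (by omega)
  | succ p ih =>
    intro f u hu
    rcases u with _ | ⟨i, u⟩
    · simp only [List.length_nil] at hu
      omega
    · simp only [evalWord_shift_succ]
      simp only [List.length_cons] at hu
      exact ih _ u (by omega)

theorem actZero_congr {x : Piece} {f g : List I → K} {n : ℕ} (hx : x.ins ≤ n)
    (h : ∀ u, u.length = n - x.ins + x.outs → f u = g u) (u : List I) (hu : u.length = n) :
    D.actZero x f u = D.actZero x g u := by
  subst hu
  rcases x with _ | _ | _ | _
  · refine congrArg D.cup (funext fun i => funext fun j => h _ ?_)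
    simp [Piece.ins, Piece.outs]
  all_goals
    rcases u with _ | ⟨i, _ | ⟨j, u⟩⟩
    · simp [Piece.ins] at hx
    · simp [Piece.ins] at hx
  · exact congrArg (D.cap i j * ·) (h u (by simp [Piece.ins, Piece.outs]))
  all_goals
    refine congrFun (congrFun (congrArg (wide q D) (funext fun i => funext fun j => h _ ?_)) i) j
    simp [Piece.ins, Piece.outs]

theorem act_congr {x : Piece} {l n : ℕ} {f g : List I → K} (hx : l + x.ins ≤ n)
    (h : ∀ u, u.length = n - x.ins + x.outs → f u = g u) (u : List I) (hu : u.length = n) :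
    D.act x l f u = D.act x l g u := by
  induction l generalizing n f g u with
  | zero => exact D.actZero_congr (by omega) h u hu
  | succ l ih =>
    rcases u with _ | ⟨i, u⟩
    · rfl
    · simp only [List.length_cons] at hu
      rw [act_succ, act_succ]
      refine ih (n := u.length) (by omega) (fun v hv => h _ ?_) u rfl
      simp only [List.length_cons]
      omega

/-- On label sequences of the right length along the lower level, the operator of a diagram depends
only on the values of the function on label sequences of the right length along the upper level. -/
theorem evalWord_congr {w : List Slice} {n m : ℕ} (hw : Fits n w m) {f g : List I → K}
    (h : ∀ u, u.length = m → f u = g u) :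
    ∀ u, u.length = n → D.evalWord w f u = D.evalWord w g u := by
  induction w generalizing n with
  | nil =>
    cases hw
    exact h
  | cons s w ih => exact fun u hu => D.act_congr hw.1 (ih hw.2) u hu

/-- The value of a closed diagram. -/
def value (T : Tangle 0 0) : K := D.evalWord T.word (fun _ => 1) []

theorem value_fill {k l : ℕ} (C : Context k l) (T : Tangle k l) : D.value (C.fill T) =
    D.evalWord C.below (D.evalWord (T.word.map (Slice.shift C.left))
      (D.evalWord C.above fun _ => 1)) [] := by
  simp only [value, Context.fill, evalWord_append]

/-- A local linear relation between small diagrams holds for the values of the diagrams obtained by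
placing them in a larger one. -/
theorem relation_value {k l : ℕ} (C : Context k l) (L : List (K × Tangle k l))
    (h : ∀ (f : List I → K) u, k ≤ u.length →
      (L.map fun t => t.1 * D.evalWord t.2.word f u).sum = 0) :
    (L.map fun t => t.1 * D.value (C.fill t.2)).sum = 0 := by
  let F (t : K × Tangle k l) : List I → K :=
    D.evalWord (t.2.word.map (Slice.shift C.left)) (D.evalWord C.above fun _ => 1)
  have hsum (M : List (List I → K)) (u : List I) : M.sum u = (M.map fun f => f u).sum :=
    map_list_sum (Pi.evalAddMonoidHom (fun _ : List I => K) u) M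
  have h₁ : ∀ u, u.length = C.left + k + C.right →
      (L.map fun t => t.1 • F t).sum u = (0 : List I → K) u := by
    intro u hu
    have h₂ := D.relation_shift (k := k) (L.map fun t => (t.1, t.2.word))
      (by simpa [Function.comp_def] using h) C.left (D.evalWord C.above fun _ => 1) u (by omega)
    simpa [Function.comp_def, hsum, F] using h₂
  have h₃ := D.evalWord_congr C.fits_below h₁ [] rfl
  rw [map_zero, map_list_sum, List.map_map, hsum] at h₃
  simpa [Function.comp_def, F, value_fill] using h₃

end YangBaxter

/-- Transport of parameters along a ring homomorphism. -/
def Params.map {k R : Type*} [CommRing k] [CommRing R] (φ : k →+* R) (q : Params k) : Params R where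
  A := φ q.A
  B := φ q.B
  a := φ q.a
  aInv := φ q.aInv
  zInv := φ q.zInv
  a_mul_aInv := by rw [← map_mul, q.a_mul_aInv, map_one]
  sub_mul_zInv := by rw [← map_sub, ← map_mul, q.sub_mul_zInv, map_one]

section Map

variable {R : Type*} [CommRing R] (φ : Coeff →+* R)

theorem map_α : φ cα = (genericParams.map φ).α := by
  simp [cα, Params.α, Params.map, genericParams]

theorem map_β : φ cβ = (genericParams.map φ).β := by
  simp [cβ, Params.β, Params.map, genericParams]

theorem map_γ : φ cγ = (genericParams.map φ).γ := by
  simp [cγ, Params.γ, Params.map, genericParams]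

theorem map_δ : φ cδ = (genericParams.map φ).δ := by
  simp [cδ, Params.δ, Params.map, genericParams]

end Map

/-- Linear maps that act on different variables commute. -/
theorem map_fun_comm {K I V : Type*} [Field K] [Finite I] (ℓ : (I → I → K) →ₗ[K] K)
    (Λ : (V → K) →ₗ[K] K) (F : I → I → V → K) :
    Λ (fun v => ℓ fun i j => F i j v) = ℓ fun i j => Λ (F i j) := by
  classical
  cases nonempty_fintype I
  have hℓ (g : I → I → K) :
      ℓ g = ∑ i, ∑ j, ℓ (Pi.single i (Pi.single j 1)) * g i j := by
    have hg : g = ∑ i, ∑ j, g i j • Pi.single i (Pi.single j 1) := by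
      funext i j
      simp [Finset.sum_apply, Pi.single_apply, ite_apply, Finset.sum_ite_eq]
    conv_lhs => rw [hg]
    simp only [map_sum, map_smul, smul_eq_mul, mul_comm]
  have hF : (fun v => ℓ fun i j => F i j v) =
      ∑ i, ∑ j, ℓ (Pi.single i (Pi.single j 1)) • F i j := by
    funext v
    rw [hℓ]
    simp [Finset.sum_apply]
  rw [hF, hℓ]
  simp only [map_sum, map_smul, smul_eq_mul]

namespace YangBaxter

variable {K : Type*} [Field K] {q : Params K} {s : K} {I : Type*} (D : YangBaxter s q.a I)

/-! #### The skein relations for values -/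

theorem act_add_two (x : Piece) (l : ℕ) (f : List I → K) (i j : I) (u : List I) :
    D.act x (2 + l) f (i :: j :: u) = D.act x l (fun v => f (i :: j :: v)) u := by
  rw [Nat.add_comm]
  rfl

theorem evalWord_exchange [Finite I] (x y : Piece) (l : ℕ) (f : List I → K) (u : List I)
    (hu : x.ins ≤ u.length) :
    D.evalWord [⟨x, 0⟩, ⟨y, x.outs + l⟩] f u = D.evalWord [⟨y, x.ins + l⟩, ⟨x, 0⟩] f u := by
  change D.actZero x (D.act y (x.outs + l) f) u = D.act y (x.ins + l) (D.actZero x f) u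
  cases x with
  | cup =>
    simp only [Piece.outs, Piece.ins, Nat.zero_add]
    change D.cup (fun i j => D.act y (2 + l) f (i :: j :: u)) = _
    simp only [act_add_two]
    exact (map_fun_comm D.cup (LinearMap.proj u ∘ₗ D.act y l) fun i j v => f (i :: j :: v)).symm
  | cap =>
    rcases u with _ | ⟨i, _ | ⟨j, u⟩⟩
    · simp [Piece.ins] at hu
    · simp [Piece.ins] at hu
    simp only [Piece.outs, Piece.ins, Nat.zero_add, act_add_two]
    exact (congrFun (map_smul (D.act y l) (D.cap i j) f) u).symm
  | vert =>
    rcases u with _ | ⟨i, _ | ⟨j, u⟩⟩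
    · simp [Piece.ins] at hu
    · simp [Piece.ins] at hu
    simp only [Piece.outs, Piece.ins, act_add_two]
    change wide q D (fun i j => D.act y (2 + l) f (i :: j :: u)) i j = _
    simp only [act_add_two]
    exact (map_fun_comm (LinearMap.proj j ∘ₗ LinearMap.proj i ∘ₗ wide q D)
      (LinearMap.proj u ∘ₗ D.act y l) fun i j v => f (i :: j :: v)).symm
  | horiz =>
    rcases u with _ | ⟨i, _ | ⟨j, u⟩⟩
    · simp [Piece.ins] at hu
    · simp [Piece.ins] at hu
    simp only [Piece.outs, Piece.ins, act_add_two]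
    change wide q D (fun i j => D.act y (2 + l) f (i :: j :: u)) i j = _
    simp only [act_add_two]
    exact (map_fun_comm (LinearMap.proj j ∘ₗ LinearMap.proj i ∘ₗ wide q D)
      (LinearMap.proj u ∘ₗ D.act y l) fun i j v => f (i :: j :: v)).symm

theorem exists_cons {n : ℕ} {u : List I} (hu : n + 1 ≤ u.length) :
    ∃ i v, u = i :: v ∧ n ≤ v.length := by
  rcases u with _ | ⟨i, v⟩
  · simp at hu
  · exact ⟨i, v, rfl, by simpa using hu⟩

theorem evalWord_isotopy [Finite I] (hs : q.A - q.B = s - s⁻¹) {k l : ℕ} {S T : Tangle k l}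
    (h : LocalIsotopy S T) (f : List I → K) (u : List I) (hu : k ≤ u.length) :
    D.evalWord S.word f u = D.evalWord T.word f u := by
  cases h with
  | exchange x y l => exact D.evalWord_exchange x y l f u (by omega)
  | zigzag_right =>
    obtain ⟨i, u, rfl, -⟩ := exists_cons hu
    exact D.zigzag' (fun i => f (i :: u)) i
  | zigzag_left =>
    obtain ⟨i, u, rfl, -⟩ := exists_cons hu
    exact D.zigzag (fun i => f (i :: u)) i
  | cap_vert =>
    obtain ⟨i, u, rfl, h₁⟩ := exists_cons hu
    obtain ⟨j, u, rfl, h₂⟩ := exists_cons h₁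
    obtain ⟨k, u, rfl, -⟩ := exists_cons h₂
    exact D.wide_cap hs (fun i => f (i :: u)) i j k
  | cap_horiz =>
    obtain ⟨i, u, rfl, h₁⟩ := exists_cons hu
    obtain ⟨j, u, rfl, h₂⟩ := exists_cons h₁
    obtain ⟨k, u, rfl, -⟩ := exists_cons h₂
    exact D.wide_cap hs (fun i => f (i :: u)) i j k
  | cup_vert =>
    obtain ⟨i, u, rfl, -⟩ := exists_cons hu
    exact D.cup_wide_turn hs (fun i j k => f (i :: j :: k :: u)) i
  | cup_horiz =>
    obtain ⟨i, u, rfl, -⟩ := exists_cons hu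
    exact D.cup_wide_turn hs (fun i j k => f (i :: j :: k :: u)) i

theorem value_isotopy [Finite I] (hs : q.A - q.B = s - s⁻¹) {k l : ℕ} {S T : Tangle k l}
    (h : LocalIsotopy S T) (C : Context k l) : D.value (C.fill S) = D.value (C.fill T) := by
  have := D.relation_value C [(1, S), (-1, T)] fun f u hu => by
    simp [D.evalWord_isotopy hs h f u hu]
  simpa [← sub_eq_add_neg, sub_eq_zero] using this

theorem value_circle (hs : q.A - q.B = s - s⁻¹) (C : Context 0 0) :
    D.value (C.fill PlanarTrivalent.circle) = q.α * D.value (C.fill (strands 0)) := by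
  have := D.relation_value C [(1, PlanarTrivalent.circle), (-q.α, strands 0)] fun f u _ => by
    have h : D.evalWord PlanarTrivalent.circle.word f u = D.cup D.cap * f u :=
      D.cup_cap_mul (f u)
    have h' : D.evalWord (strands 0).word f u = f u := rfl
    simp [h, h', D.cup_cap hs]
  simpa [← sub_eq_add_neg, sub_eq_zero] using this

theorem value_flip (C : Context 2 2) :
    D.value (C.fill vertical) = D.value (C.fill horizontal) := by
  have := D.relation_value C [(1, vertical), (-1, horizontal)] fun f u hu => by
    obtain ⟨i, u, rfl, h₁⟩ := exists_cons hu
    obtain ⟨j, u, rfl, -⟩ := exists_cons h₁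
    have h : D.evalWord vertical.word f (i :: j :: u) =
      D.evalWord horizontal.word f (i :: j :: u) := rfl
    simp [h]
  simpa [← sub_eq_add_neg, sub_eq_zero] using this

theorem value_bypass (hs : q.A - q.B = s - s⁻¹) (C : Context 1 1) :
    D.value (C.fill bypass) = q.β * D.value (C.fill (strands 1)) := by
  have := D.relation_value C [(1, PlanarTrivalent.bypass), (-q.β, strands 1)] fun f u hu => by
    obtain ⟨i, u, rfl, -⟩ := exists_cons hu
    have h : D.evalWord PlanarTrivalent.bypass.word f (i :: u) = q.β * f (i :: u) :=
      D.cup_wide_cap hs (fun i => f (i :: u)) i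
    have h' : D.evalWord (strands 1).word f (i :: u) = f (i :: u) := rfl
    simp [h, h']
  simpa [← sub_eq_add_neg, sub_eq_zero] using this

theorem value_digon (hs : q.A - q.B = s - s⁻¹) (C : Context 2 2) :
    D.value (C.fill digon) = (1 - q.A * q.B) * D.value (C.fill (strands 2))
      + q.γ * D.value (C.fill turnback) - (q.A + q.B) * D.value (C.fill vertical) := by
  have := D.relation_value C [(1, digon), (-(1 - q.A * q.B), strands 2), (-q.γ, turnback),
      (q.A + q.B, vertical)] fun f u hu => by
    obtain ⟨i, u, rfl, h₁⟩ := exists_cons hu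
    obtain ⟨j, u, rfl, -⟩ := exists_cons h₁
    have h : D.evalWord digon.word f (i :: j :: u) =
        (1 - q.A * q.B) * D.evalWord (strands 2).word f (i :: j :: u)
          + q.γ * D.evalWord turnback.word f (i :: j :: u)
          - (q.A + q.B) * D.evalWord vertical.word f (i :: j :: u) :=
      congrFun (congrFun (LinearMap.congr_fun (D.wide_mul_wide hs) fun i j => f (i :: j :: u)) i) j
    simp only [List.map_cons, List.map_nil, List.sum_cons, List.sum_nil]
    rw [h]
    ring
  simp only [List.map_cons, List.map_nil, List.sum_cons, List.sum_nil] at this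
  linear_combination this

theorem value_triple (hs : q.A - q.B = s - s⁻¹) (C : Context 3 3) :
    D.value (C.fill ⟨c₂ ++ (c₁ ++ c₂), fits_c₂.append (fits_c₁.append fits_c₂)⟩)
      - D.value (C.fill ⟨c₁ ++ (c₂ ++ c₁), fits_c₁.append (fits_c₂.append fits_c₁)⟩) =
    q.A * q.B *
      (D.value (C.fill ⟨c₂, fits_c₂⟩) - D.value (C.fill ⟨c₁, fits_c₁⟩)
        + D.value (C.fill ⟨t₂ ++ c₁, fits_t₂.append fits_c₁⟩)
        - D.value (C.fill ⟨t₁ ++ c₂, fits_t₁.append fits_c₂⟩)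
        + D.value (C.fill ⟨c₁ ++ t₂, fits_c₁.append fits_t₂⟩)
        - D.value (C.fill ⟨c₂ ++ t₁, fits_c₂.append fits_t₁⟩))
    + q.δ * (D.value (C.fill ⟨t₁, fits_t₁⟩) - D.value (C.fill ⟨t₂, fits_t₂⟩)) := by
  have := D.relation_value C
    [(1, ⟨c₂ ++ (c₁ ++ c₂), fits_c₂.append (fits_c₁.append fits_c₂)⟩),
      (-1, ⟨c₁ ++ (c₂ ++ c₁), fits_c₁.append (fits_c₂.append fits_c₁)⟩),
      (-(q.A * q.B), ⟨c₂, fits_c₂⟩), (q.A * q.B, ⟨c₁, fits_c₁⟩),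
      (-(q.A * q.B), ⟨t₂ ++ c₁, fits_t₂.append fits_c₁⟩),
      (q.A * q.B, ⟨t₁ ++ c₂, fits_t₁.append fits_c₂⟩),
      (-(q.A * q.B), ⟨c₁ ++ t₂, fits_c₁.append fits_t₂⟩),
      (q.A * q.B, ⟨c₂ ++ t₁, fits_c₂.append fits_t₁⟩),
      (-q.δ, ⟨t₁, fits_t₁⟩), (q.δ, ⟨t₂, fits_t₂⟩)] fun f u hu => by
    obtain ⟨i, u, rfl, h₁⟩ := exists_cons hu
    obtain ⟨j, u, rfl, h₂⟩ := exists_cons h₁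
    obtain ⟨k, u, rfl, -⟩ := exists_cons h₂
    let v (w : List Slice) : K := D.evalWord w f (i :: j :: k :: u)
    have h : v (c₂ ++ (c₁ ++ c₂)) - v (c₁ ++ (c₂ ++ c₁)) =
        q.A * q.B * (v c₂ - v c₁ + v (t₂ ++ c₁) - v (t₁ ++ c₂) + v (c₁ ++ t₂) - v (c₂ ++ t₁))
          + q.δ * (v t₁ - v t₂) :=
      congrFun (congrFun (congrFun (LinearMap.congr_fun (D.triple_wide hs rfl rfl rfl rfl)
        fun i j k => f (i :: j :: k :: u)) i) j) k
    simp only [List.map_cons, List.map_nil, List.sum_cons, List.sum_nil]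
    linear_combination h
  simp only [List.map_cons, List.map_nil, List.sum_cons, List.sum_nil] at this
  linear_combination this

end YangBaxter

/-- A solution of the Yang–Baxter equation yields a solution of the graph skein relations. The
values are divided by the value of the circle, so that the unknot obtains the value `1`. -/
theorem exists_graphSkein {K : Type*} [Field K] (φ : Coeff →+* K) {s : K} {I : Type*} [Finite I]
    (hs : φ vA - φ vB = s - s⁻¹) (D : YangBaxter s (φ va) I) (hα : φ cα ≠ 0) :
    ∃ P, GraphSkein φ P := by
  let q := genericParams.map φ
  change YangBaxter s q.a I at D
  change q.A - q.B = s - s⁻¹ at hs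
  rw [map_α] at hα
  change q.α ≠ 0 at hα
  refine ⟨Quot.lift (fun E => D.value E.tangle * q.α⁻¹) ?_, ?_⟩
  · rintro E E' ⟨k, l, C, S, T, h, hE, hE'⟩
    rw [hE, hE', D.value_isotopy hs h]
  · refine ⟨?_, fun C h => ?_, fun C => ?_, fun C => ?_, fun C => ?_, fun C => ?_⟩
    · change D.cup (fun i j => D.cap i j * 1) * q.α⁻¹ = 1
      rw [D.cup_cap_mul, D.cup_cap hs, mul_one, mul_inv_cancel₀ hα]
    · change D.value _ * q.α⁻¹ = φ cα * (D.value _ * q.α⁻¹)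
      rw [map_α, D.value_circle hs, mul_assoc]
    · exact congrArg (· * q.α⁻¹) (D.value_flip C)
    · change D.value (C.fill bypass) * q.α⁻¹ = φ cβ * (D.value (C.fill (strands 1)) * q.α⁻¹)
      rw [map_β, D.value_bypass hs, mul_assoc]
    · have h := D.value_digon hs C
      change D.value (C.fill digon) * q.α⁻¹ =
        φ (1 - vA * vB) * (D.value (C.fill (strands 2)) * q.α⁻¹)
        + φ cγ * (D.value (C.fill turnback) * q.α⁻¹)
        - φ (vA + vB) * (D.value (C.fill vertical) * q.α⁻¹)
      rw [map_γ, h, map_sub, map_mul, map_one, map_add]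
      change _ = (1 - q.A * q.B) * _ + q.γ * _ - (q.A + q.B) * _
      ring
    · have h := D.value_triple hs C
      have key : ∀ x₁ x₂ y₁ y₂ y₃ y₄ y₅ y₆ z₁ z₂ : K, x₁ - x₂ =
          q.A * q.B * (y₁ - y₂ + y₃ - y₄ + y₅ - y₆) + q.δ * (z₁ - z₂) →
          x₁ * q.α⁻¹ - x₂ * q.α⁻¹ = φ (vA * vB) * (y₁ * q.α⁻¹ - y₂ * q.α⁻¹ + y₃ * q.α⁻¹
            - y₄ * q.α⁻¹ + y₅ * q.α⁻¹ - y₆ * q.α⁻¹) + φ cδ * (z₁ * q.α⁻¹ - z₂ * q.α⁻¹) := by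
        intro x₁ x₂ y₁ y₂ y₃ y₄ y₅ y₆ z₁ z₂ h
        rw [map_δ, map_mul]
        change _ = q.A * q.B * _ + q.δ * _
        linear_combination q.α⁻¹ * h
      exact key _ _ _ _ _ _ _ _ _ _ h

/-! ### Specialisation -/

/-- The point `(A, B, a)` of a specialisation: real numbers `0 < B < A`, and a number `n` that
determines `a`. -/
structure Point : Type where
  A : ℝ
  B : ℝ
  n : ℕ
  B_pos : 0 < B
  B_lt_A : B < A

namespace Point

variable (x : Point)

/-- The root `s > 1` of `s - s⁻¹ = A - B`. -/
def s : ℝ := (x.A - x.B + √((x.A - x.B) ^ 2 + 4)) / 2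

theorem one_lt_s : 1 < x.s := by
  have h := x.B_lt_A
  have h' : 2 ≤ √((x.A - x.B) ^ 2 + 4) := Real.le_sqrt_of_sq_le (by nlinarith)
  unfold s
  linarith

theorem sub_eq : x.A - x.B = x.s - x.s⁻¹ := by
  have hs : x.s ≠ 0 := (zero_lt_one.trans x.one_lt_s).ne'
  have h : x.s ^ 2 = (x.A - x.B) * x.s + 1 := by
    have := Real.sq_sqrt (show 0 ≤ (x.A - x.B) ^ 2 + 4 by positivity)
    unfold s
    linear_combination this / 4
  field_simp
  linear_combination -h

/-- The value `s ^ (2 n + 1)` of the variable `a`. -/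
def a : ℝ := x.s⁻¹ * (x.s ^ 2) ^ (x.n + 1)

theorem one_lt_a : 1 < x.a := by
  have h := x.one_lt_s
  have e : x.a = x.s * (x.s ^ 2) ^ x.n := by
    have : x.s ≠ 0 := by positivity
    unfold a
    field_simp
    ring
  rw [e]
  exact one_lt_mul_of_lt_of_le h (one_le_pow₀ (one_le_pow₀ h.le))

/-- Evaluation of polynomials in `A`, `B`, `a` at the point. -/
def evalPoly : MvPolynomial (Fin 3) ℤ →+* ℝ :=
  MvPolynomial.eval₂Hom (Int.castRingHom ℝ) ![x.A, x.B, x.a]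

theorem isUnit_evalPoly (d : denominators) : IsUnit (x.evalPoly d) := by
  have h : denominators ≤ (IsUnit.submonoid ℝ).comap x.evalPoly := by
    refine (Submonoid.closure_le).2 ?_
    have h₀ := x.B_pos
    have h₁ := x.B_lt_A
    have h₂ := x.one_lt_a
    rintro f (rfl | rfl | rfl | rfl) <;>
      simp [evalPoly, IsUnit.mem_submonoid_iff, sub_eq_zero] <;> linarith
  exact h d.2

/-- Evaluation of coefficients at the point. -/
def evalCoeff : Coeff →+* ℝ := IsLocalization.lift (M := denominators) x.isUnit_evalPoly

theorem evalCoeff_algebraMap (f : MvPolynomial (Fin 3) ℤ) :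
    x.evalCoeff (algebraMap _ Coeff f) = x.evalPoly f :=
  IsLocalization.lift_eq _ f

@[simp]
theorem evalCoeff_vA : x.evalCoeff vA = x.A := by simp [vA, evalCoeff_algebraMap, evalPoly]

@[simp]
theorem evalCoeff_vB : x.evalCoeff vB = x.B := by simp [vB, evalCoeff_algebraMap, evalPoly]

@[simp]
theorem evalCoeff_va : x.evalCoeff va = x.a := by simp [va, evalCoeff_algebraMap, evalPoly]

theorem evalCoeff_α_ne_zero : x.evalCoeff cα ≠ 0 := by
  have ha := x.one_lt_a
  have hz := sub_pos.2 x.B_lt_A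
  have h₁ : x.evalCoeff vaInv = x.a⁻¹ := by
    refine eq_inv_of_mul_eq_one_right ?_
    rw [← evalCoeff_va, ← map_mul, va_mul_vaInv, map_one]
  have h₂ : x.evalCoeff vzInv = (x.A - x.B)⁻¹ := by
    refine eq_inv_of_mul_eq_one_right ?_
    rw [← evalCoeff_vA, ← evalCoeff_vB, ← map_sub, ← map_mul, sub_mul_vzInv, map_one]
  have h₃ : x.a⁻¹ < x.a := (inv_lt_one_of_one_lt₀ ha).trans ha
  simp only [cα, map_add, map_mul, map_sub, map_one, evalCoeff_va, h₁, h₂]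
  have := mul_pos (sub_pos.2 h₃) (inv_pos.2 hz)
  linarith

theorem exists_graphSkein : ∃ P, GraphSkein x.evalCoeff P := by
  have hs := x.one_lt_s
  obtain ⟨I, _, ⟨D⟩⟩ := exists_yangBaxter (zero_lt_one.trans hs).ne' (x.n + 1)
  have ha : x.s⁻¹ * (x.s ^ 2) ^ (x.n + 1) = x.evalCoeff va := x.evalCoeff_va.symm
  rw [ha] at D
  exact PlanarTrivalent.exists_graphSkein x.evalCoeff
    (by rw [evalCoeff_vA, evalCoeff_vB, sub_eq]) D x.evalCoeff_α_ne_zero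

end Point

/-- A polynomial that vanishes at all points is zero: for given `A` and `B` it vanishes for the
infinitely many values `s ^ (2 n + 1)` of `a`, hence for every `a`. -/
theorem eq_zero_of_evalPoly_eq_zero {f : MvPolynomial (Fin 3) ℤ}
    (hf : ∀ x : Point, x.evalPoly f = 0) : f = 0 := by
  have h (A B : ℝ) (hB : 0 < B) (hA : B < A) (a : ℝ) :
      MvPolynomial.eval₂Hom (Int.castRingHom ℝ) ![A, B, a] f = 0 := by
    let F : Polynomial ℝ := MvPolynomial.eval₂Hom (Int.castRingHom (Polynomial ℝ))
      ![Polynomial.C A, Polynomial.C B, Polynomial.X] f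
    have hF (b : ℝ) : F.eval b = MvPolynomial.eval₂Hom (Int.castRingHom ℝ) ![A, B, b] f := by
      have e : (Polynomial.evalRingHom b).comp (MvPolynomial.eval₂Hom
          (Int.castRingHom (Polynomial ℝ)) ![Polynomial.C A, Polynomial.C B, Polynomial.X]) =
          MvPolynomial.eval₂Hom (Int.castRingHom ℝ) ![A, B, b] := by
        refine MvPolynomial.ringHom_ext (by simp) fun i => ?_
        fin_cases i <;> simp
      exact RingHom.congr_fun e f
    have hF0 : F = 0 := by
      refine Polynomial.eq_zero_of_infinite_isRoot F
        (Set.infinite_of_injective_forall_mem (f := fun n : ℕ => (⟨A, B, n, hB, hA⟩ : Point).a)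
          (fun m n hmn => ?_) fun n => ?_)
      · have hs := (⟨A, B, 0, hB, hA⟩ : Point).one_lt_s
        have := mul_left_cancel₀ (inv_ne_zero (zero_lt_one.trans hs).ne') hmn
        exact Nat.succ_injective (pow_right_injective₀ (by positivity)
          (one_lt_pow₀ hs two_ne_zero).ne' this)
      · exact (hF _).trans (hf ⟨A, B, n, hB, hA⟩)
    rw [← hF, hF0, Polynomial.eval_zero]
  refine MvPolynomial.map_injective (Int.castRingHom ℝ) Int.cast_injective ?_
  rw [map_zero]
  refine MvPolynomial.funext_set ![Set.Ioo 1 2, Set.Ioo 0 1, Set.univ] ?_ fun v hv => ?_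
  · intro i
    fin_cases i
    · exact Set.Ioo_infinite one_lt_two
    · exact Set.Ioo_infinite zero_lt_one
    · exact Set.infinite_univ
  · have h₀ : v 0 ∈ Set.Ioo (1 : ℝ) 2 := hv 0 trivial
    have h₁ : v 1 ∈ Set.Ioo (0 : ℝ) 1 := hv 1 trivial
    have e : v = ![v 0, v 1, v 2] := by
      funext i
      fin_cases i <;> rfl
    rw [map_zero, MvPolynomial.eval_map, e]
    exact h _ _ h₁.1 (h₁.2.trans h₀.1) _

/-- A coefficient is determined by its values at all points. -/
theorem evalCoeff_injective : Function.Injective (RingHom.pi Point.evalCoeff) := by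
  refine (injective_iff_map_eq_zero _).2 fun c hc => ?_
  obtain ⟨⟨f, d⟩, h⟩ := IsLocalization.surj denominators c
  have hf : f = 0 := eq_zero_of_evalPoly_eq_zero fun x => by
    have hx : x.evalCoeff c = 0 := congrFun hc x
    rw [← x.evalCoeff_algebraMap, ← h, map_mul, hx, zero_mul]
  rw [hf, map_zero] at h
  exact ((IsLocalization.map_units Coeff d).mul_left_eq_zero).1 h

/-- A solution with values in an extension of the ring of coefficients takes its values in
the ring of coefficients. -/
theorem GraphSkein.exists_isGraphPolynomial {R : Type*} [CommRing R] {φ : Coeff →+* R}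
    {P : Diagram → R} (hP : GraphSkein φ P) (hφ : Function.Injective φ) :
    ∃ Q, IsGraphPolynomial Q := by
  choose Q hQ using hP.mem_range
  refine ⟨Q, ⟨?_, ?_, ?_, ?_, ?_, ?_⟩⟩
  all_goals intros
  all_goals apply hφ
  all_goals simp only [map_one, map_mul, map_add, map_sub, ← hQ]
  · exact hP.unknot
  · exact hP.circle _ _
  · exact hP.flip _
  · exact hP.bypass _
  · simpa only [map_one, map_mul, map_add, map_sub] using hP.digon _
  · simpa only [map_one, map_mul, map_add, map_sub] using hP.triple _

theorem exists_isGraphPolynomial : ∃ Q, IsGraphPolynomial Q := by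
  choose P hP using Point.exists_graphSkein
  have h : GraphSkein (RingHom.pi Point.evalCoeff) fun D x => P x D :=
    ⟨funext fun x => (hP x).unknot, fun C h => funext fun x => (hP x).circle C h,
      fun C => funext fun x => (hP x).flip C, fun C => funext fun x => (hP x).bypass C,
      fun C => funext fun x => (hP x).digon C, fun C => funext fun x => (hP x).triple C⟩
  exact h.exists_isGraphPolynomial evalCoeff_injective

/-- Two solutions together form one with values in `Coeff × Coeff`, whose values lie in the image
of `Coeff`, that is, on the diagonal. -/
theorem IsGraphPolynomial.unique {P Q : Diagram → Coeff} (hP : IsGraphPolynomial P)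
    (hQ : IsGraphPolynomial Q) : P = Q := by
  have h : GraphSkein ((RingHom.id Coeff).prod (RingHom.id Coeff)) fun D => (P D, Q D) :=
    ⟨Prod.ext hP.unknot hQ.unknot, fun C h => Prod.ext (hP.circle C h) (hQ.circle C h),
      fun C => Prod.ext (hP.flip C) (hQ.flip C), fun C => Prod.ext (hP.bypass C) (hQ.bypass C),
      fun C => Prod.ext (hP.digon C) (hQ.digon C), fun C => Prod.ext (hP.triple C) (hQ.triple C)⟩
  funext D
  obtain ⟨x, hx⟩ := h.mem_range D
  exact (congrArg Prod.fst hx).trans (congrArg Prod.snd hx).symm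

end PlanarTrivalent

end

theorem theorem2p2 :
    ∃! P : PlanarTrivalent.Diagram → PlanarTrivalent.Coeff,
      PlanarTrivalent.IsGraphPolynomial P := by
  obtain ⟨P, hP⟩ := PlanarTrivalent.exists_isGraphPolynomial
  exact ⟨P, hP, fun Q hQ => hQ.unique hP⟩
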